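/- **Theorem.** Consider the holomorphic two-form $$\Omega=\frac{dt_1\wedge dt_2}{\sqrt{t_1t_2(1-t_1)(1-t_2)\,(1-z_1t_1-(1-z_2)t_2)}},\qquad (x,y)=(z_1,1-z_2),$$ and its Picard–Fuchs system, the Appell $F_2$ system with $\alpha=\beta_1=\beta_2=\tfrac12$, $\gamma_1=\gamma_2=1$: $$x(1-x)F_{xx}-xyF_{xy}+(1-2x)F_x-\tfrac12 yF_y-\tfrac14F=0,\qquad y(1-y)F_{yy}-xyF_{xy}+(1-2y)F_y-\tfrac12 xF_x-\tfrac14F=0 .$$ Let $$T(\Lambda_1,\Lambda_2)=\left(\frac{4\Lambda_1\Lambda_2}{(\Lambda_1+\Lambda_2)^2},\;-\frac{(1-\Lambda_1^2)(1-\Lambda_2^2)}{(\Lambda_1+\Lambda_2)^2}\right)\quad(\Lambda_1+\Lambda_2\ne0),\qquad K(m)=\int_0^{\pi/2}\frac{d\theta}{\sqrt{1-m\sin^2\theta}}\quad(m\in\mathbb C\setminus[1,\infty)),$$ with the principal square root in $K$. 1. There are a connected open neighbourhood $N$ of $(0,0)$ in $\mathbb C^2$ and a holomorphic map $(\Lambda_1,\Lambda_2):N\to\mathbb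 C^2$ with $T(\Lambda_1,\Lambda_2)=(x,y)$, $|\Lambda_1^2|<1$, $|1-\Lambda_2^2|<1$ and $\Lambda_1+\Lambda_2\neq0$ on $N$, and $(\Lambda_1,\Lambda_2)(0,0)=(0,1)$; the points of $N$ where $\Lambda_1^2\notin(-\infty,0]$ and $1-\Lambda_2^2\notin(-\infty,0]$ are dense in $N$. Moreover, for $(x,y)\in N$ the form (with the principal square root) is absolutely integrable over $[0,1]^2$, and $\int_{[0,1]^2}\Omega$ is a holomorphic solution of the system on $N$. 2. Let $U\subset\mathbb C^2$ be a nonempty connected open set and $(\Lambda_1,\Lambda_2):U\to\mathbb C^2$ any holomorphic map with $T(\Lambda_1,\Lambda_2)=(x,y)$, $\Lambda_1+\Lambda_2\ne0$, $|\Lambda_1^2|<1$, $|1-\Lambda_2^2|<1$ on $U$, and such that $\Lambda_1^2\notin(-\infty,0]$, $1-\Lambda_2^2\notin(-\infty,0]$ on $U$ (so that the principal branches of $K(1-\Lambda_1^2)$ and $K(\Lambda_2^2)$ are holomorphic). Then $$\begin{aligned}\Pi_0&=\tfrac{4}{\pi^2}(\Lambda_1+\Lambda_2)K(\Lambda_1^2)K(1-\Lambda_2^2),&\Pi_1&=\tfrac{4i}{\pi^2}(\Lambda_1+\Lambda_2)K(1-\Lambda_1^2)K(1-\Lambda_2^2),\\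 \Pi_2&=\tfrac{4i}{\pi^2}(\Lambda_1+\Lambda_2)K(\Lambda_1^2)K(\Lambda_2^2),&\Pi_3&=\tfrac{4i^2}{\pi^2}(\Lambda_1+\Lambda_2)K(1-\Lambda_1^2)K(\Lambda_2^2)\end{aligned}$$ form a basis of the complex vector space of holomorphic solutions of the system on $U$. If $V\supset U$ is a connected open set to which $\Pi_0,\dots,\Pi_3$ extend holomorphically, their extensions form a basis of the space of holomorphic solutions on $V$. -/

import Mathlib

open Set Filter Topology MeasureTheory

noncomputable section

/-- The partial derivative `∂F/∂x` of a function of two complex variables `(x, y)`. -/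
def partialX (F : ℂ × ℂ → ℂ) (p : ℂ × ℂ) : ℂ := fderiv ℂ F p (1, 0)

/-- The partial derivative `∂F/∂y` of a function of two complex variables `(x, y)`. -/
def partialY (F : ℂ × ℂ → ℂ) (p : ℂ × ℂ) : ℂ := fderiv ℂ F p (0, 1)

/-- `F` is a holomorphic solution on `U` of the Appell `F₂` system with parameters
`(α; β₁, β₂; γ₁, γ₂)`. -/
structure IsAppellF2Solution (α β₁ β₂ γ₁ γ₂ : ℂ) (U : Set (ℂ × ℂ)) (F : ℂ × ℂ → ℂ) : Prop where
  holomorphic : AnalyticOnNhd ℂ F U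
  eqX : ∀ x y : ℂ, (x, y) ∈ U →
    x * (1 - x) * partialX (partialX F) (x, y) - x * y * partialX (partialY F) (x, y)
      + (γ₁ - (α + β₁ + 1) * x) * partialX F (x, y) - β₁ * y * partialY F (x, y)
      - α * β₁ * F (x, y) = 0
  eqY : ∀ x y : ℂ, (x, y) ∈ U →
    y * (1 - y) * partialY (partialY F) (x, y) - x * y * partialX (partialY F) (x, y)
      + (γ₂ - (α + β₂ + 1) * y) * partialY F (x, y) - β₂ * x * partialX F (x, y)
      - α * β₂ * F (x, y) = 0

theorem IsAppellF2Solution.zero (α β₁ β₂ γ₁ γ₂ : ℂ) (U : Set (ℂ × ℂ)) :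
    IsAppellF2Solution α β₁ β₂ γ₁ γ₂ U (fun _ => 0) := by
  have hx : partialX (fun _ => (0 : ℂ)) = fun _ => 0 := by
    funext p; simp [partialX]
  have hy : partialY (fun _ => (0 : ℂ)) = fun _ => 0 := by
    funext p; simp [partialY]
  refine ⟨analyticOnNhd_const, fun x y _ => ?_, fun x y _ => ?_⟩ <;> simp [hx, hy]

theorem partialX_analyticAt {F : ℂ × ℂ → ℂ} {p : ℂ × ℂ} (hF : AnalyticAt ℂ F p) :
    AnalyticAt ℂ (partialX F) p :=
  ((ContinuousLinearMap.apply ℂ ℂ ((1, 0) : ℂ × ℂ)).analyticAt _).comp hF.fderiv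

theorem partialY_analyticAt {F : ℂ × ℂ → ℂ} {p : ℂ × ℂ} (hF : AnalyticAt ℂ F p) :
    AnalyticAt ℂ (partialY F) p :=
  ((ContinuousLinearMap.apply ℂ ℂ ((0, 1) : ℂ × ℂ)).analyticAt _).comp hF.fderiv

theorem partial_smul_add {F G : ℂ × ℂ → ℂ} {p : ℂ × ℂ} (c : ℂ) (hF : AnalyticAt ℂ F p)
    (hG : AnalyticAt ℂ G p) :
    partialX (fun q => c * F q + G q) p = c * partialX F p + partialX G p ∧
      partialY (fun q => c * F q + G q) p = c * partialY F p + partialY G p := by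
  have hf := hF.differentiableAt
  have hg := hG.differentiableAt
  have h : fderiv ℂ (fun q => c * F q + G q) p = c • fderiv ℂ F p + fderiv ℂ G p :=
    ((hf.hasFDerivAt.const_mul c).add hg.hasFDerivAt).fderiv
  simp [partialX, partialY, h]

theorem partial_congr {F G : ℂ × ℂ → ℂ} {p : ℂ × ℂ} (h : F =ᶠ[𝓝 p] G) :
    partialX F p = partialX G p ∧ partialY F p = partialY G p := by
  simp [partialX, partialY, h.fderiv_eq]

theorem IsAppellF2Solution.smul_add {α β₁ β₂ γ₁ γ₂ : ℂ} {U : Set (ℂ × ℂ)} {F G : ℂ × ℂ → ℂ}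
    (c : ℂ) (hF : IsAppellF2Solution α β₁ β₂ γ₁ γ₂ U F)
    (hG : IsAppellF2Solution α β₁ β₂ γ₁ γ₂ U G) :
    IsAppellF2Solution α β₁ β₂ γ₁ γ₂ U (fun q => c * F q + G q) := by
  have key : ∀ p ∈ U,
      partialX (partialX (fun q => c * F q + G q)) p
          = c * partialX (partialX F) p + partialX (partialX G) p ∧
      partialX (partialY (fun q => c * F q + G q)) p
          = c * partialX (partialY F) p + partialX (partialY G) p ∧
      partialY (partialY (fun q => c * F q + G q)) p
          = c * partialY (partialY F) p + partialY (partialY G) p := by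
    intro p hp
    have hf := hF.holomorphic p hp
    have hg := hG.holomorphic p hp
    have ev : ∀ᶠ r in 𝓝 p, AnalyticAt ℂ F r ∧ AnalyticAt ℂ G r :=
      hf.eventually_analyticAt.and hg.eventually_analyticAt
    have eX : partialX (fun q => c * F q + G q) =ᶠ[𝓝 p]
        fun q => c * partialX F q + partialX G q := by
      filter_upwards [ev] with r hr using (partial_smul_add c hr.1 hr.2).1
    have eY : partialY (fun q => c * F q + G q) =ᶠ[𝓝 p]
        fun q => c * partialY F q + partialY G q := by
      filter_upwards [ev] with r hr using (partial_smul_add c hr.1 hr.2).2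
    have hX := partial_smul_add c (partialX_analyticAt hf) (partialX_analyticAt hg)
    have hY := partial_smul_add c (partialY_analyticAt hf) (partialY_analyticAt hg)
    exact ⟨(partial_congr eX).1.trans hX.1, (partial_congr eY).1.trans hY.1,
      (partial_congr eY).2.trans hY.2⟩
  refine ⟨fun p hp => (analyticAt_const.mul (hF.holomorphic p hp)).add (hG.holomorphic p hp),
    fun x y h => ?_, fun x y h => ?_⟩
  · obtain ⟨h1, h2, _⟩ := key _ h
    obtain ⟨h4, h5⟩ := partial_smul_add c (hF.holomorphic _ h) (hG.holomorphic _ h)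
    rw [h1, h2, h4, h5]
    linear_combination c * hF.eqX x y h + hG.eqX x y h
  · obtain ⟨_, h2, h3⟩ := key _ h
    obtain ⟨h4, h5⟩ := partial_smul_add c (hF.holomorphic _ h) (hG.holomorphic _ h)
    rw [h2, h3, h4, h5]
    linear_combination c * hF.eqY x y h + hG.eqY x y h

/-- The complex vector space of holomorphic solutions on `U` of the Appell `F₂` system, as
functions on `U`. -/
def appellF2Solutions (α β₁ β₂ γ₁ γ₂ : ℂ) (U : Set (ℂ × ℂ)) : Submodule ℂ (U → ℂ) where
  carrier := {f | ∃ F, IsAppellF2Solution α β₁ β₂ γ₁ γ₂ U F ∧ ∀ p : U, f p = F p}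
  zero_mem' := ⟨_, IsAppellF2Solution.zero α β₁ β₂ γ₁ γ₂ U, fun _ => rfl⟩
  add_mem' := by
    rintro f g ⟨F, hF, hf⟩ ⟨G, hG, hg⟩
    exact ⟨_, hF.smul_add 1 hG, fun p => by simp [hf p, hg p]⟩
  smul_mem' := by
    rintro c f ⟨F, hF, hf⟩
    exact ⟨_, hF.smul_add c (IsAppellF2Solution.zero α β₁ β₂ γ₁ γ₂ U),
      fun p => by simp [hf p]⟩

/-- Solutions on `U` of the Picard-Fuchs system of the traintrack K3 form: the Appell `F₂` system
with `α = β₁ = β₂ = 1/2` and `γ₁ = γ₂ = 1`. -/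
abbrev traintrackSolutions (U : Set (ℂ × ℂ)) : Submodule ℂ (U → ℂ) :=
  appellF2Solutions (1 / 2) (1 / 2) (1 / 2) 1 1 U

/-- The coefficient of `dt₁ ∧ dt₂` in the holomorphic two-form
`dt₁ ∧ dt₂ / √(t₁ t₂ (1 - t₁) (1 - t₂) (1 - z₁ t₁ - (1 - z₂) t₂))`, at real `t = (t₁, t₂)`, with the
principal square root. -/
def traintrackForm (z₁ z₂ : ℂ) (t : ℝ × ℝ) : ℂ :=
  1 / ((t.1 * t.2 * (1 - t.1) * (1 - t.2) * (1 - z₁ * t.1 - (1 - z₂) * t.2) : ℂ) ^ (1 / 2 : ℂ))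

/-- The unit square, over which the two-form is integrated. -/
def unitSquare : Set (ℝ × ℝ) := Icc 0 1 ×ˢ Icc 0 1

/-- The period of the two-form over the unit square, in the variables `(x, y) = (z₁, 1 - z₂)`. -/
def traintrackPeriod (p : ℂ × ℂ) : ℂ :=
  ∫ t in unitSquare, traintrackForm p.1 (1 - p.2) t

/-- The complete elliptic integral of the first kind as a function of the parameter
`m ∉ [1, ∞)` (the square of the modulus): `K(m) = ∫_0^{π/2} dθ / √(1 - m sin² θ)`, with the
principal square root. -/
def ellipticK (m : ℂ) : ℂ :=
  ∫ θ in (0 : ℝ)..(Real.pi / 2), 1 / (1 - m * ((Real.sin θ : ℝ) : ℂ) ^ 2) ^ (1 / 2 : ℂ)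

/-- The change of variables `T(Λ₁, Λ₂)`, used only where `Λ₁ + Λ₂ ≠ 0`. -/
def cdmT (l : ℂ × ℂ) : ℂ × ℂ :=
  (4 * l.1 * l.2 / (l.1 + l.2) ^ 2, -((1 - l.1 ^ 2) * (1 - l.2 ^ 2)) / (l.1 + l.2) ^ 2)

/-- The range of `(Λ₁, Λ₂)`: `|Λ₁²| < 1` and `|1 - Λ₂²| < 1`, with `T` defined. -/
def lambdaRange : Set (ℂ × ℂ) :=
  {l | ‖l.1 ^ 2‖ < 1 ∧ ‖1 - l.2 ^ 2‖ < 1 ∧ l.1 + l.2 ≠ 0}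

/-- The part of the range on which `K(1 - Λ₁²)` and `K(Λ₂²)` are off the branch cut `[1, ∞)` of the
principal branch of `K`. -/
def slitLambdaRange : Set (ℂ × ℂ) :=
  {l | l ∈ lambdaRange ∧ l.1 ^ 2 ∈ Complex.slitPlane ∧ 1 - l.2 ^ 2 ∈ Complex.slitPlane}

/-- `lam` is a holomorphic inverse on `U` of the change of variables `T`, with values in `R`. -/
structure IsLambdaBranch (R : Set (ℂ × ℂ)) (U : Set (ℂ × ℂ)) (lam : ℂ × ℂ → ℂ × ℂ) : Prop where
  holomorphic : AnalyticOnNhd ℂ lam U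
  mem_range : ∀ p ∈ U, lam p ∈ R
  inverse : ∀ p ∈ U, cdmT (lam p) = p

/-- The four products `Π₀, Π₁, Π₂, Π₃` as functions of `(Λ₁, Λ₂)`. -/
def ellipticProduct (l : ℂ × ℂ) : Fin 4 → ℂ :=
  ![4 / (Real.pi : ℂ) ^ 2 * (l.1 + l.2) * ellipticK (l.1 ^ 2) * ellipticK (1 - l.2 ^ 2),
    4 * Complex.I / (Real.pi : ℂ) ^ 2 * (l.1 + l.2) * ellipticK (1 - l.1 ^ 2)
      * ellipticK (1 - l.2 ^ 2),
    4 * Complex.I / (Real.pi : ℂ) ^ 2 * (l.1 + l.2) * ellipticK (l.1 ^ 2) * ellipticK (l.2 ^ 2),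
    4 * Complex.I ^ 2 / (Real.pi : ℂ) ^ 2 * (l.1 + l.2) * ellipticK (1 - l.1 ^ 2)
      * ellipticK (l.2 ^ 2)]

/-- The restrictions to `U` of the four functions `P i` form a basis of the vector space of
solutions on `U`. -/
def IsSolutionBasis (U : Set (ℂ × ℂ)) (P : ℂ × ℂ → Fin 4 → ℂ) : Prop :=
  ∃ b : Module.Basis (Fin 4) ℂ (traintrackSolutions U),
    ∀ (i : Fin 4) (p : U), (b i : U → ℂ) p = P p i

end

/-!
The Appell system with parameters `α = β₁ = β₂ = 1/2`, `γ₁ = γ₂ = 1` separates in the variables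
`(Λ₁, Λ₂)`: if `A` and `B` solve the differential equation of the complete elliptic integral as a
function of the modulus, `(Λ₁ + Λ₂) A(Λ₁) B(Λ₂)` solves the system
(`isAppellF2Solution_legendreProd`). This is a chain-rule computation in which the partial
derivatives of `(Λ₁, Λ₂)` are rational functions, found by differentiating `T(Λ) = (x, y)`
(`lam_partials`); the same identity shows that the values of `(Λ₁, Λ₂)` avoid the critical locus
of `T`, so that a branch is a local homeomorphism and stays off the singular locus of the system.
`K(k²)` and `K(1 - k²)` solve the one-variable equation (`ellipticK_ode`), and so the four products
are solutions.

They are independent because `K(m)` and `K(1 - m)` are (`ellipticK_independent`): a relation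
continues analytically to `m = 1/2`, where the value and the derivative decide it. They span because
a solution on a connected open set is determined by `F`, `∂F/∂x`, `∂F/∂y` and `∂²F/∂x∂y` at one
regular point (`eqOn_zero_of_jet_eq_zero`): the system and its derivatives form a Pfaffian system
for these four functions, and Grönwall's inequality together with the identity theorem gives
uniqueness. So the space of solutions has dimension at most four, also on a larger connected set to
which the products continue.

For the period, `(1 - x t₁ - y t₂)^{-1/2}` is an analytic function of `(x, y)` with values in the
Banach algebra of bounded continuous functions of `(t₁, t₂)`, by the binomial series; integration
against the arcsine weights is a continuous linear functional on this algebra, which gives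
holomorphy and differentiation under the integral sign at once. Each equation of the system turns
the weighted integrand into a total derivative in one of the variables `t₁`, `t₂`, of a function
that vanishes on the boundary (`integral_arcsineWeight_eq_zero`). Near the origin the inverse of `T`
is explicit in terms of `√(1 - x)`, `√(1 - y)` and `√(1 - x - y)` (`originBranch`).
-/

/-! ### The inverse square root -/

/-- The principal branch of `w ↦ 1 / √w`, with the value `0` at `0`. Its derivatives are polynomials
in it, so that the differential equations below become polynomial identities modulo
`invSqrt w ^ 2 * w = 1`. -/
noncomputable def invSqrt (w : ℂ) : ℂ := w ^ (-(1 / 2) : ℂ)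

theorem one_div_cpow_half (w : ℂ) : 1 / w ^ (1 / 2 : ℂ) = invSqrt w := by
  rw [invSqrt, Complex.cpow_neg, one_div]

theorem invSqrt_sq_mul {w : ℂ} (hw : w ≠ 0) : invSqrt w ^ 2 * w = 1 := by
  rw [invSqrt, ← Complex.cpow_nat_mul]
  norm_num [Complex.cpow_neg_one, hw]

theorem hasDerivAt_invSqrt {w : ℂ} (hw : w ∈ Complex.slitPlane) :
    HasDerivAt invSqrt (-(1 / 2) * invSqrt w ^ 3) w := by
  have h := (hasDerivAt_id w).cpow_const (c := (-(1 / 2) : ℂ)) hw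
  convert! h using 1
  simp only [id, mul_one, invSqrt]
  rw [← Complex.cpow_nat_mul]
  norm_num

theorem invSqrt_ofReal {r : ℝ} (hr : 0 ≤ r) : invSqrt r = ((√r)⁻¹ : ℝ) := by
  rw [invSqrt, Complex.cpow_neg, Real.sqrt_eq_rpow, Complex.ofReal_inv, Complex.ofReal_cpow hr]
  norm_num

theorem invSqrt_ofReal_mul {r : ℝ} (hr : 0 < r) {w : ℂ} (hw : w ≠ 0) :
    invSqrt (r * w) = invSqrt r * invSqrt w := by
  have hr' : (r : ℂ) ≠ 0 := by exact_mod_cast hr.ne'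
  rw [invSqrt, invSqrt, invSqrt, Complex.cpow_def_of_ne_zero (mul_ne_zero hr' hw),
    Complex.cpow_def_of_ne_zero hr', Complex.cpow_def_of_ne_zero hw, Complex.log_ofReal_mul hr hw,
    ← Complex.exp_add, ← Complex.ofReal_log hr.le]
  ring_nf

theorem one_sub_mul_mem_slitPlane {m : ℂ} (hm : 1 - m ∈ Complex.slitPlane) {u : ℝ} (h0 : 0 ≤ u)
    (h1 : u ≤ 1) : 1 - m * u ∈ Complex.slitPlane := by
  have := Complex.starConvex_one_slitPlane hm (sub_nonneg.2 h1) h0 (by ring)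
  convert this using 1
  simp only [Complex.real_smul]
  push_cast
  ring

/-! ### The complete elliptic integral -/

theorem one_sub_mul_sin_sq_mem_slitPlane {m : ℂ} (hm : 1 - m ∈ Complex.slitPlane) (θ : ℝ) :
    1 - m * ((Real.sin θ : ℝ) : ℂ) ^ 2 ∈ Complex.slitPlane := by
  have := one_sub_mul_mem_slitPlane hm (sq_nonneg (Real.sin θ)) (Real.sin_sq_le_one θ)
  simpa using this

theorem isOpen_one_sub_slit : IsOpen {m : ℂ | 1 - m ∈ Complex.slitPlane} :=
  Complex.isOpen_slitPlane.preimage (by fun_prop)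

theorem continuousOn_ellipticIntegrand {c : ℝ → ℂ} (hc : Continuous c) (k : ℕ) :
    ContinuousOn (fun q : ℂ × ℝ => c q.2 * invSqrt (1 - q.1 * ((Real.sin q.2 : ℝ) : ℂ) ^ 2) ^ k)
      ({m : ℂ | 1 - m ∈ Complex.slitPlane} ×ˢ univ) := by
  refine (by fun_prop : Continuous fun q : ℂ × ℝ => c q.2).continuousOn.mul (ContinuousOn.pow ?_ k)
  intro q hq
  have h1 := (hasDerivAt_invSqrt (one_sub_mul_sin_sq_mem_slitPlane hq.1 q.2)).continuousAt
  exact (h1.comp (f := fun q : ℂ × ℝ => 1 - q.1 * ((Real.sin q.2 : ℝ) : ℂ) ^ 2)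
    (by fun_prop : Continuous _).continuousAt).continuousWithinAt

theorem continuous_ellipticIntegrand {c : ℝ → ℂ} (hc : Continuous c) (k : ℕ) {m : ℂ}
    (hm : 1 - m ∈ Complex.slitPlane) :
    Continuous fun θ : ℝ => c θ * invSqrt (1 - m * ((Real.sin θ : ℝ) : ℂ) ^ 2) ^ k :=
  (continuousOn_ellipticIntegrand hc k).comp_continuous (f := fun θ : ℝ => (m, θ)) (by fun_prop)
    (fun _ => ⟨hm, mem_univ _⟩)

/-- Differentiation under the integral sign for the elliptic integrals
`∫_0^{π/2} c(θ) (1 - m sin² θ)^{-k/2} dθ`. -/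
theorem hasDerivAt_ellipticIntegral {c : ℝ → ℂ} (hc : Continuous c) (k : ℕ) {m : ℂ}
    (hm : 1 - m ∈ Complex.slitPlane) :
    HasDerivAt (fun m : ℂ => ∫ θ in (0 : ℝ)..(Real.pi / 2),
        c θ * invSqrt (1 - m * ((Real.sin θ : ℝ) : ℂ) ^ 2) ^ k)
      (∫ θ in (0 : ℝ)..(Real.pi / 2), c θ * (k / 2 * ((Real.sin θ : ℝ) : ℂ) ^ 2) *
        invSqrt (1 - m * ((Real.sin θ : ℝ) : ℂ) ^ 2) ^ (k + 2)) m := by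
  obtain ⟨ε, hε, hball⟩ := Metric.nhds_basis_closedBall.mem_iff.1 (isOpen_one_sub_slit.mem_nhds hm)
  have hc' : Continuous fun θ : ℝ => c θ * (k / 2 * ((Real.sin θ : ℝ) : ℂ) ^ 2) := by fun_prop
  have hcomp : IsCompact (Metric.closedBall m ε ×ˢ Icc (0 : ℝ) (Real.pi / 2)) :=
    (isCompact_closedBall m ε).prod isCompact_Icc
  obtain ⟨C, hC⟩ := hcomp.exists_bound_of_continuousOn
    ((continuousOn_ellipticIntegrand hc' (k + 2)).mono (prod_mono hball (subset_univ _)))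
  refine (intervalIntegral.hasDerivAt_integral_of_dominated_loc_of_deriv_le
    (F := fun (m : ℂ) (θ : ℝ) => c θ * invSqrt (1 - m * ((Real.sin θ : ℝ) : ℂ) ^ 2) ^ k)
    (F' := fun (m : ℂ) (θ : ℝ) => c θ * (k / 2 * ((Real.sin θ : ℝ) : ℂ) ^ 2) *
        invSqrt (1 - m * ((Real.sin θ : ℝ) : ℂ) ^ 2) ^ (k + 2)) (bound := fun _ => C)
    (Metric.closedBall_mem_nhds m hε) ?_ ?_ ?_ ?_ ?_ ?_).2
  · filter_upwards [isOpen_one_sub_slit.mem_nhds hm] with z hz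
    exact (continuous_ellipticIntegrand hc k hz).aestronglyMeasurable
  · exact (continuous_ellipticIntegrand hc k hm).intervalIntegrable _ _
  · exact (continuous_ellipticIntegrand hc' (k + 2) hm).aestronglyMeasurable
  · refine ae_of_all _ fun θ hθ z hz => hC (z, θ) ⟨hz, ?_⟩
    rw [uIoc_of_le (by positivity)] at hθ
    exact Ioc_subset_Icc_self hθ
  · exact intervalIntegrable_const
  · refine ae_of_all _ fun θ _ z hz => ?_
    have h1 : HasDerivAt (fun z : ℂ => 1 - z * ((Real.sin θ : ℝ) : ℂ) ^ 2)
        (-((Real.sin θ : ℝ) : ℂ) ^ 2) z := by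
      simpa using ((hasDerivAt_id z).mul_const (((Real.sin θ : ℝ) : ℂ) ^ 2)).const_sub 1
    have h2 := (((hasDerivAt_invSqrt (one_sub_mul_sin_sq_mem_slitPlane (hball hz) θ)).comp z
      h1).pow k).const_mul (c θ)
    convert! h2 using 1
    rcases k with _ | k
    · simp
    · simp only [Function.comp_apply, Nat.add_sub_cancel]
      push_cast
      ring

theorem ellipticK_eq (m : ℂ) : ellipticK m = ∫ θ in (0 : ℝ)..(Real.pi / 2),
    1 * invSqrt (1 - m * ((Real.sin θ : ℝ) : ℂ) ^ 2) ^ 1 := by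
  simp only [ellipticK, one_div_cpow_half, one_mul, pow_one]

theorem hasDerivAt_ellipticK {m : ℂ} (hm : 1 - m ∈ Complex.slitPlane) :
    HasDerivAt ellipticK (∫ θ in (0 : ℝ)..(Real.pi / 2), 1 / 2 * ((Real.sin θ : ℝ) : ℂ) ^ 2 *
        invSqrt (1 - m * ((Real.sin θ : ℝ) : ℂ) ^ 2) ^ 3) m := by
  have h := hasDerivAt_ellipticIntegral (c := fun _ => 1) continuous_const 1 hm
  rw [← funext ellipticK_eq] at h
  simpa using h

theorem hasDerivAt_deriv_ellipticK {m : ℂ} (hm : 1 - m ∈ Complex.slitPlane) :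
    HasDerivAt (deriv ellipticK)
      (∫ θ in (0 : ℝ)..(Real.pi / 2), 3 / 4 * ((Real.sin θ : ℝ) : ℂ) ^ 4 *
        invSqrt (1 - m * ((Real.sin θ : ℝ) : ℂ) ^ 2) ^ 5) m := by
  have h := hasDerivAt_ellipticIntegral
    (c := fun θ => 1 / 2 * ((Real.sin θ : ℝ) : ℂ) ^ 2) (by fun_prop) 3 hm
  have h' := h.congr_of_eventuallyEq (f₁ := deriv ellipticK) (by
    filter_upwards [isOpen_one_sub_slit.mem_nhds hm] with z hz
    exact (hasDerivAt_ellipticK hz).deriv)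
  convert! h' using 1
  refine intervalIntegral.integral_congr fun θ _ => ?_
  push_cast
  ring

theorem analyticAt_ellipticK {m : ℂ} (hm : 1 - m ∈ Complex.slitPlane) : AnalyticAt ℂ ellipticK m :=
  DifferentiableOn.analyticAt (s := {m : ℂ | 1 - m ∈ Complex.slitPlane})
    (fun _ hz => (hasDerivAt_ellipticK hz).differentiableAt.differentiableWithinAt)
    (isOpen_one_sub_slit.mem_nhds hm)

/-- The hypergeometric equation of `K`: the operator applied to the integrand is the `θ`-derivative
of `-sin θ cos θ (1 - m sin² θ)^{-3/2} / 4`, which vanishes at both ends. -/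
theorem ellipticK_ode {m : ℂ} (hm : 1 - m ∈ Complex.slitPlane) :
    m * (1 - m) * deriv (deriv ellipticK) m + (1 - 2 * m) * deriv ellipticK m
      - 1 / 4 * ellipticK m = 0 := by
  have hcont : ∀ (c : ℝ → ℂ) (_ : Continuous c) (k : ℕ), IntervalIntegrable
      (fun θ : ℝ => c θ * invSqrt (1 - m * ((Real.sin θ : ℝ) : ℂ) ^ 2) ^ k) volume 0
      (Real.pi / 2) :=
    fun c hc k => (continuous_ellipticIntegrand hc k hm).intervalIntegrable _ _
  have i2 := hcont (fun θ => 3 / 4 * ((Real.sin θ : ℝ) : ℂ) ^ 4) (by fun_prop) 5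
  have i1 := hcont (fun θ => 1 / 2 * ((Real.sin θ : ℝ) : ℂ) ^ 2) (by fun_prop) 3
  have i0 := hcont (fun _ => 1) (by fun_prop) 1
  rw [(hasDerivAt_deriv_ellipticK hm).deriv, (hasDerivAt_ellipticK hm).deriv, ellipticK_eq,
    ← intervalIntegral.integral_const_mul, ← intervalIntegral.integral_const_mul,
    ← intervalIntegral.integral_const_mul, ← intervalIntegral.integral_add (i2.const_mul _)
      (i1.const_mul _), ← intervalIntegral.integral_sub ((i2.const_mul _).add (i1.const_mul _))
      (i0.const_mul _)]
  have key : ∀ θ : ℝ, HasDerivAt (fun θ : ℝ => -(1 / 4) * (((Real.sin θ * Real.cos θ : ℝ) : ℂ) *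
        invSqrt (1 - m * ((Real.sin θ : ℝ) : ℂ) ^ 2) ^ 3))
      (m * (1 - m) * (3 / 4 * ((Real.sin θ : ℝ) : ℂ) ^ 4 *
        invSqrt (1 - m * ((Real.sin θ : ℝ) : ℂ) ^ 2) ^ 5) + (1 - 2 * m) *
        (1 / 2 * ((Real.sin θ : ℝ) : ℂ) ^ 2 *
        invSqrt (1 - m * ((Real.sin θ : ℝ) : ℂ) ^ 2) ^ 3) -
        1 / 4 * (1 * invSqrt (1 - m * ((Real.sin θ : ℝ) : ℂ) ^ 2) ^ 1)) θ := by
    intro θ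
    have hw := one_sub_mul_sin_sq_mem_slitPlane hm θ
    have h1 : HasDerivAt (fun θ : ℝ => 1 - m * ((Real.sin θ : ℝ) : ℂ) ^ 2)
        (-(m * (2 * Real.sin θ * Real.cos θ))) θ := by
      have := (((Real.hasDerivAt_sin θ).ofReal_comp.pow 2).const_mul m).const_sub 1
      simpa using this
    have h2 := ((hasDerivAt_invSqrt hw).comp θ h1).pow 3
    have h3 := ((Real.hasDerivAt_sin θ).mul (Real.hasDerivAt_cos θ)).ofReal_comp
    have h4 := (h3.mul h2).const_mul (-(1 / 4) : ℂ)
    have e := invSqrt_sq_mul (Complex.slitPlane_ne_zero hw)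
    have hcs : ((Real.cos θ : ℝ) : ℂ) ^ 2 = 1 - ((Real.sin θ : ℝ) : ℂ) ^ 2 := by
      exact_mod_cast Real.cos_sq' θ
    convert! h4 using 1
    simp only [Function.comp_apply, Pi.pow_apply, Pi.mul_apply]
    push_cast
    push_cast at e hcs
    generalize hh : invSqrt (1 - m * Complex.sin θ ^ 2) = h at *
    generalize Complex.sin θ = s at *
    generalize Complex.cos θ = c at *
    linear_combination (-((1 - 2 * m) / 2 * s ^ 2 + (1 - 2 * s ^ 2) / 4) * h ^ 3
      + h / 4 * (h ^ 2 * (1 - m * s ^ 2) + 1)) * e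
      + (h ^ 3 / 4 + 3 / 4 * m * s ^ 2 * h ^ 5) * hcs
  rw [intervalIntegral.integral_eq_sub_of_hasDerivAt (fun θ _ => key θ)
    (((i2.const_mul _).add (i1.const_mul _)).sub (i0.const_mul _))]
  simp

/-- At `m = 1 / 2` the integrand is real and positive. -/
theorem ellipticIntegral_half_ne_zero {c : ℝ → ℝ} (hc : Continuous c)
    (hpos : ∀ θ ∈ Ioo 0 (Real.pi / 2), 0 < c θ) (k : ℕ) :
    ∫ θ in (0 : ℝ)..(Real.pi / 2),
      (c θ : ℂ) * invSqrt (1 - 1 / 2 * ((Real.sin θ : ℝ) : ℂ) ^ 2) ^ k ≠ 0 := by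
  have hw : ∀ θ : ℝ, 0 < 1 - 1 / 2 * Real.sin θ ^ 2 := fun θ => by
    nlinarith [Real.sin_sq_le_one θ]
  have e : ∀ θ : ℝ, (c θ : ℂ) * invSqrt (1 - 1 / 2 * ((Real.sin θ : ℝ) : ℂ) ^ 2) ^ k =
      ((c θ * (√(1 - 1 / 2 * Real.sin θ ^ 2))⁻¹ ^ k : ℝ) : ℂ) := fun θ => by
    have := invSqrt_ofReal (hw θ).le
    push_cast at this ⊢
    rw [this]
  simp only [e]
  rw [intervalIntegral.integral_ofReal]
  have hpi : (0 : ℝ) < Real.pi / 2 := by positivity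
  have : 0 < ∫ θ in (0 : ℝ)..(Real.pi / 2), c θ * (√(1 - 1 / 2 * Real.sin θ ^ 2))⁻¹ ^ k := by
    refine intervalIntegral.intervalIntegral_pos_of_pos_on ?_ (fun θ hθ => ?_) hpi
    · refine (hc.mul (Continuous.pow (Continuous.inv₀ (by fun_prop) fun θ => ?_) k)
        ).intervalIntegrable _ _
      exact (Real.sqrt_pos.2 (hw θ)).ne'
    · exact mul_pos (hpos θ hθ) (pow_pos (inv_pos.2 (Real.sqrt_pos.2 (hw θ))) k)
  exact_mod_cast this.ne'

theorem half_mem_slit : (1 : ℂ) - 1 / 2 ∈ Complex.slitPlane := by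
  rw [show (1 : ℂ) - 1 / 2 = ((1 / 2 : ℝ) : ℂ) by norm_num]
  exact Complex.ofReal_mem_slitPlane.2 (by norm_num)

theorem ellipticK_half_ne_zero : ellipticK (1 / 2) ≠ 0 := by
  rw [ellipticK_eq]
  simpa using ellipticIntegral_half_ne_zero (c := fun _ => 1) continuous_const
    (fun _ _ => one_pos) 1

theorem deriv_ellipticK_half_ne_zero : deriv ellipticK (1 / 2) ≠ 0 := by
  rw [(hasDerivAt_ellipticK half_mem_slit).deriv]
  have := ellipticIntegral_half_ne_zero (c := fun θ => 1 / 2 * Real.sin θ ^ 2) (by fun_prop)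
    (fun θ hθ => by
      have := Real.sin_pos_of_mem_Ioo ⟨hθ.1, by linarith [hθ.2, Real.pi_pos]⟩
      positivity) 3
  simpa using this

/-- `K(m)` and `K(1 - m)` are linearly independent near any point of their common domain: a
relation `a K(m) + b K(1 - m) = 0` propagates to `m = 1 / 2`, where its value is `(a + b) K` and
its derivative is `(a - b) K'`. -/
theorem ellipticK_independent {a b m₀ : ℂ} (h0 : m₀ ∈ Complex.slitPlane)
    (h1 : 1 - m₀ ∈ Complex.slitPlane)
    (h : ∀ᶠ m in 𝓝 m₀, a * ellipticK m + b * ellipticK (1 - m) = 0) : a = 0 ∧ b = 0 := by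
  -- the common domain of `K(m)` and `K(1 - m)` is star-shaped about `1 / 2`
  set D : Set ℂ := {m | m ∈ Complex.slitPlane ∧ 1 - m ∈ Complex.slitPlane} with hD
  have hhalf : (1 / 2 : ℂ) ∈ D := by
    refine ⟨?_, half_mem_slit⟩
    have := half_mem_slit
    norm_num at this ⊢
    exact this
  have key : ∀ z : ℂ, z ∈ Complex.slitPlane → ∀ t : ℝ, 0 ≤ t → t ≤ 1 →
      (1 - t : ℂ) * (1 / 2) + t * z ∈ Complex.slitPlane := by
    intro z hz t ht0 ht1
    rw [Complex.mem_slitPlane_iff] at hz ⊢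
    simp only [Complex.add_re, Complex.mul_re, Complex.sub_re, Complex.one_re, Complex.ofReal_re,
      Complex.sub_im, Complex.one_im, Complex.ofReal_im, Complex.add_im, Complex.mul_im]
    norm_num
    rcases ht0.eq_or_lt with rfl | ht
    · left; norm_num
    · rcases hz with hz | hz
      · left; nlinarith [mul_pos ht hz]
      · right; exact ⟨ht.ne', hz⟩
  have hstar : StarConvex ℝ (1 / 2 : ℂ) D := by
    intro z hz p q hp hq hpq
    obtain rfl : p = 1 - q := by linarith
    have h1 := key z hz.1 q hq (by linarith)
    have h2 := key (1 - z) hz.2 q hq (by linarith)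
    simp only [hD, mem_ofPred_eq, Complex.real_smul]
    push_cast
    refine ⟨h1, ?_⟩
    convert h2 using 1
    ring
  have hconn : IsPreconnected D := (hstar.isPathConnected hhalf).isConnected.isPreconnected
  have hder : ∀ m ∈ D, HasDerivAt (fun m => a * ellipticK m + b * ellipticK (1 - m))
      (a * deriv ellipticK m - b * deriv ellipticK (1 - m)) m := by
    intro m hm
    have d1 := (hasDerivAt_ellipticK hm.2).differentiableAt.hasDerivAt
    have d2 := (hasDerivAt_ellipticK (m := 1 - m) (by simpa using hm.1)).differentiableAt.hasDerivAt
    have d3 := (d1.const_mul a).add ((d2.comp m ((hasDerivAt_id m).const_sub 1)).const_mul b)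
    convert! d3 using 1
    ring
  have hopen : IsOpen D := Complex.isOpen_slitPlane.inter isOpen_one_sub_slit
  have han : AnalyticOnNhd ℂ (fun m => a * ellipticK m + b * ellipticK (1 - m)) D :=
    DifferentiableOn.analyticOnNhd
      (fun z hz => (hder z hz).differentiableAt.differentiableWithinAt) hopen
  have hz : EqOn (fun m => a * ellipticK m + b * ellipticK (1 - m)) 0 D :=
    han.eqOn_zero_of_preconnected_of_eventuallyEq_zero hconn ⟨h0, h1⟩ h
  have v0 : a * ellipticK (1 / 2) + b * ellipticK (1 - 1 / 2) = 0 := hz hhalf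
  have v1 : a * deriv ellipticK (1 / 2) - b * deriv ellipticK (1 - 1 / 2) = 0 := by
    rw [← (hder _ hhalf).deriv, Filter.EventuallyEq.deriv_eq (f := fun _ => (0 : ℂ))
      (hz.eventuallyEq_of_mem (hopen.mem_nhds hhalf))]
    simp
  rw [show (1 : ℂ) - 1 / 2 = 1 / 2 by norm_num] at v0 v1
  have e0 : a + b = 0 := by
    have : (a + b) * ellipticK (1 / 2) = 0 := by linear_combination v0
    exact (mul_eq_zero.1 this).resolve_right ellipticK_half_ne_zero
  have e1 : a - b = 0 := by
    have : (a - b) * deriv ellipticK (1 / 2) = 0 := by linear_combination v1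
    exact (mul_eq_zero.1 this).resolve_right deriv_ellipticK_half_ne_zero
  constructor
  · linear_combination (e0 + e1) / 2
  · linear_combination (e0 - e1) / 2

/-! ### Partial derivatives and the chain rule -/

theorem hasDerivAt_partialX {F : ℂ × ℂ → ℂ} {x y : ℂ} (hF : DifferentiableAt ℂ F (x, y)) :
    HasDerivAt (fun x' => F (x', y)) (partialX F (x, y)) x :=
  HasFDerivAt.comp_hasDerivAt (f := fun x' : ℂ => (x', y)) x hF.hasFDerivAt
    ((hasDerivAt_id x).prodMk (hasDerivAt_const x y))

theorem hasDerivAt_partialY {F : ℂ × ℂ → ℂ} {x y : ℂ} (hF : DifferentiableAt ℂ F (x, y)) :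
    HasDerivAt (fun y' => F (x, y')) (partialY F (x, y)) y :=
  HasFDerivAt.comp_hasDerivAt (f := fun y' : ℂ => (x, y')) y hF.hasFDerivAt
    ((hasDerivAt_const y x).prodMk (hasDerivAt_id y))

theorem fderiv_apply_eq_partial (F : ℂ × ℂ → ℂ) (p v : ℂ × ℂ) :
    fderiv ℂ F p v = v.1 * partialX F p + v.2 * partialY F p := by
  have : v = v.1 • ((1, 0) : ℂ × ℂ) + v.2 • ((0, 1) : ℂ × ℂ) := by
    ext <;> simp
  conv_lhs => rw [this, map_add, map_smul, map_smul]
  rfl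

theorem partial_comp {F : ℂ × ℂ → ℂ} {lam : ℂ × ℂ → ℂ × ℂ} {z : ℂ × ℂ} {d₁ d₂ : ℂ}
    (hF : DifferentiableAt ℂ F (lam z)) (hlam : DifferentiableAt ℂ lam z)
    (h₁ : HasDerivAt (fun p => F (p, (lam z).2)) d₁ (lam z).1)
    (h₂ : HasDerivAt (fun r => F ((lam z).1, r)) d₂ (lam z).2) (v : ℂ × ℂ) :
    fderiv ℂ (fun w => F (lam w)) z v = (fderiv ℂ lam z v).1 * d₁ + (fderiv ℂ lam z v).2 * d₂ := by
  have hc : HasFDerivAt (fun w => F (lam w)) ((fderiv ℂ F (lam z)).comp (fderiv ℂ lam z)) z :=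
    hF.hasFDerivAt.comp z hlam.hasFDerivAt
  rw [hc.fderiv, ContinuousLinearMap.comp_apply, fderiv_apply_eq_partial]
  rw [(hasDerivAt_partialX hF).unique h₁, (hasDerivAt_partialY hF).unique h₂]

theorem partialY_partialX {F : ℂ × ℂ → ℂ} {p : ℂ × ℂ} (hF : AnalyticAt ℂ F p) :
    partialY (partialX F) p = partialX (partialY F) p := by
  have hd : DifferentiableAt ℂ (fderiv ℂ F) p := hF.fderiv.differentiableAt
  have h : ∀ v w : ℂ × ℂ, fderiv ℂ (fun q => fderiv ℂ F q v) p w = fderiv ℂ (fderiv ℂ F) p w v :=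
    fun v w => by
      have : HasFDerivAt (fun q => fderiv ℂ F q v)
          ((ContinuousLinearMap.apply ℂ ℂ v).comp (fderiv ℂ (fderiv ℂ F) p)) p :=
        (ContinuousLinearMap.apply ℂ ℂ v).hasFDerivAt.comp p hd.hasFDerivAt
      rw [this.fderiv]
      simp
  have hs : IsSymmSndFDerivAt ℂ F p :=
    (hF.contDiffAt (n := 2)).isSymmSndFDerivAt (by simp)
  change fderiv ℂ (fun q => fderiv ℂ F q (1, 0)) p (0, 1) =
    fderiv ℂ (fun q => fderiv ℂ F q (0, 1)) p (1, 0)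
  rw [h, h]
  exact hs _ _

/-! ### The Jacobian of the change of variables -/

/-- Differentiating `T(lam) = id` at `z` in the direction `v`. -/
theorem cdmT_tangent {lam : ℂ × ℂ → ℂ × ℂ} {z : ℂ × ℂ} (hlam : DifferentiableAt ℂ lam z)
    (hinv : ∀ᶠ w in 𝓝 z, cdmT (lam w) = w) (hs : (lam z).1 + (lam z).2 ≠ 0) (v : ℂ × ℂ) :
    4 * ((lam z).2 - (lam z).1) *
        ((lam z).2 * (fderiv ℂ lam z v).1 - (lam z).1 * (fderiv ℂ lam z v).2) =
      v.1 * ((lam z).1 + (lam z).2) ^ 3 ∧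
    2 * (1 + (lam z).1 * (lam z).2) *
        ((1 - (lam z).2 ^ 2) * (fderiv ℂ lam z v).1 +
          (1 - (lam z).1 ^ 2) * (fderiv ℂ lam z v).2) =
      v.2 * ((lam z).1 + (lam z).2) ^ 3 := by
  have hline : HasDerivAt (fun t : ℂ => z + t • v) v 0 := by
    simpa using ((hasDerivAt_id (0 : ℂ)).smul_const v).const_add z
  have hl0 : HasDerivAt (fun t : ℂ => lam (z + t • v)) (fderiv ℂ lam z v) 0 := by
    have h : HasFDerivAt lam (fderiv ℂ lam z) (z + (0 : ℂ) • v) := by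
      simpa using hlam.hasFDerivAt
    exact h.comp_hasDerivAt (0 : ℂ) hline
  have hp : HasDerivAt (fun t : ℂ => (lam (z + t • v)).1) (fderiv ℂ lam z v).1 0 := by
    have := (ContinuousLinearMap.fst ℂ ℂ ℂ).hasFDerivAt.comp_hasDerivAt (0 : ℂ) hl0
    simpa using! this
  have hr : HasDerivAt (fun t : ℂ => (lam (z + t • v)).2) (fderiv ℂ lam z v).2 0 := by
    have := (ContinuousLinearMap.snd ℂ ℂ ℂ).hasFDerivAt.comp_hasDerivAt (0 : ℂ) hl0
    simpa using! this
  have hev : ∀ᶠ t : ℂ in 𝓝 0, cdmT (lam (z + t • v)) = z + t • v := by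
    have : Tendsto (fun t : ℂ => z + t • v) (𝓝 0) (𝓝 z) := by
      simpa using hline.continuousAt.tendsto
    exact this.eventually hinv
  have hev0 : ∀ᶠ t : ℂ in 𝓝 0, (lam (z + t • v)).1 + (lam (z + t • v)).2 ≠ 0 :=
    (hp.add hr).continuousAt.eventually_ne (by simpa using hs)
  have hx : HasDerivAt (fun t : ℂ => z.1 + t * v.1) v.1 0 := by
    simpa using ((hasDerivAt_id (0 : ℂ)).mul_const v.1).const_add z.1
  have hy : HasDerivAt (fun t : ℂ => z.2 + t * v.2) v.2 0 := by
    simpa using ((hasDerivAt_id (0 : ℂ)).mul_const v.2).const_add z.2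
  have hz := hev.self_of_nhds
  simp only [zero_smul, add_zero] at hz
  have hz1 : 4 * (lam z).1 * (lam z).2 / ((lam z).1 + (lam z).2) ^ 2 = z.1 := congrArg Prod.fst hz
  have hz2 : -((1 - (lam z).1 ^ 2) * (1 - (lam z).2 ^ 2)) / ((lam z).1 + (lam z).2) ^ 2 = z.2 :=
    congrArg Prod.snd hz
  have e1 : (fun t : ℂ => 4 * ((lam (z + t • v)).1 * (lam (z + t • v)).2)) =ᶠ[𝓝 0]
      fun t => (z.1 + t * v.1) * ((lam (z + t • v)).1 + (lam (z + t • v)).2) ^ 2 := by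
    filter_upwards [hev, hev0] with t ht ht0
    have := congrArg Prod.fst ht
    simp only [cdmT, Prod.fst_add, Prod.smul_fst, smul_eq_mul] at this
    rw [← this]
    field_simp
  have e2 : (fun t : ℂ => -((1 - (lam (z + t • v)).1 ^ 2) * (1 - (lam (z + t • v)).2 ^ 2)))
      =ᶠ[𝓝 0]
      fun t => (z.2 + t * v.2) * ((lam (z + t • v)).1 + (lam (z + t • v)).2) ^ 2 := by
    filter_upwards [hev, hev0] with t ht ht0
    have := congrArg Prod.snd ht
    simp only [cdmT, Prod.snd_add, Prod.smul_snd, smul_eq_mul] at this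
    rw [← this]
    field_simp
  have d1 := ((hp.mul hr).const_mul 4).unique
    ((hx.mul ((hp.add hr).pow 2)).congr_of_eventuallyEq e1)
  have d2 := (((hp.pow 2).const_sub 1).mul ((hr.pow 2).const_sub 1)).neg.unique
    ((hy.mul ((hp.add hr).pow 2)).congr_of_eventuallyEq e2)
  simp only [zero_smul, zero_mul, add_zero, Pi.pow_apply, Pi.add_apply, Nat.cast_ofNat,
    Nat.add_one_sub_one, pow_one] at d1 d2
  rw [← hz1] at d1
  rw [← hz2] at d2
  generalize (lam z).1 = p at *
  generalize (lam z).2 = r at *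
  generalize (fderiv ℂ lam z v).1 = p' at *
  generalize (fderiv ℂ lam z v).2 = r' at *
  field_simp at d1 d2
  constructor
  · linear_combination d1
  · linear_combination d2

/-- The partial derivatives of an inverse `lam` of `T`, and the locus that its values avoid because
its derivative is invertible. -/
theorem lam_partials {lam : ℂ × ℂ → ℂ × ℂ} {z : ℂ × ℂ} (hlam : DifferentiableAt ℂ lam z)
    (hinv : ∀ᶠ w in 𝓝 z, cdmT (lam w) = w) {p r : ℂ} (hpr : lam z = (p, r)) (hs : p + r ≠ 0) :
    (r - p ≠ 0 ∧ 1 - p * r ≠ 0 ∧ 1 + p * r ≠ 0) ∧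
    fderiv ℂ lam z (1, 0) = ((1 - p ^ 2) * (p + r) ^ 2 / (4 * (r - p) * (1 - p * r)),
      -((1 - r ^ 2) * (p + r) ^ 2 / (4 * (r - p) * (1 - p * r)))) ∧
    fderiv ℂ lam z (0, 1) = (p * (p + r) ^ 2 / (2 * (1 + p * r) * (1 - p * r)),
      r * (p + r) ^ 2 / (2 * (1 + p * r) * (1 - p * r))) := by
  have hs' : (lam z).1 + (lam z).2 ≠ 0 := by simpa [hpr] using hs
  have hX := cdmT_tangent hlam hinv hs' (1, 0)
  have hY := cdmT_tangent hlam hinv hs' (0, 1)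
  simp only [hpr] at hX hY
  generalize fderiv ℂ lam z (1, 0) = u at *
  generalize fderiv ℂ lam z (0, 1) = v at *
  obtain ⟨a, b⟩ := u
  obtain ⟨c, d⟩ := v
  simp only [one_mul, zero_mul] at hX hY
  obtain ⟨x1, x2⟩ := hX
  obtain ⟨y1, y2⟩ := hY
  have hs3 : (p + r) ^ 3 ≠ 0 := pow_ne_zero 3 hs
  have n1 : r - p ≠ 0 := by
    intro h; apply hs3; rw [← x1, h]; ring
  have n3 : 1 + p * r ≠ 0 := by
    intro h; apply hs3; rw [← y2, h]; ring
  have hα : r * c - p * d = 0 :=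
    (mul_eq_zero.1 y1).resolve_left (mul_ne_zero (by norm_num) n1)
  have hβ : (1 - r ^ 2) * a + (1 - p ^ 2) * b = 0 :=
    (mul_eq_zero.1 x2).resolve_left (mul_ne_zero (by norm_num) n3)
  have n2 : 1 - p * r ≠ 0 := by
    intro h
    -- `p β + (1 - p²) α = s (1 - p r) c` with `α = 0` and `β ≠ 0` would force `p = 0`
    have hp : p * (p + r) ^ 3 = 0 := by
      linear_combination -p * y2 - 2 * (1 + p * r) * (1 - p ^ 2) * hα
        + 2 * (1 + p * r) * (p + r) * c * h
    have : p = 0 := (mul_eq_zero.1 hp).resolve_right hs3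
    simp [this] at h
  refine ⟨⟨n1, n2, n3⟩, Prod.ext ?_ ?_, Prod.ext ?_ ?_⟩
  · simp only
    rw [eq_div_iff (by simp [n1, n2])]
    refine mul_left_cancel₀ hs ?_
    linear_combination (1 - p ^ 2) * x1 + 4 * (r - p) * p * hβ
  · simp only
    rw [← neg_div, eq_div_iff (by simp [n1, n2])]
    refine mul_left_cancel₀ hs ?_
    linear_combination -(1 - r ^ 2) * x1 + 4 * (r - p) * r * hβ
  · simp only
    rw [eq_div_iff (by simp [n2, n3])]
    refine mul_left_cancel₀ hs ?_
    linear_combination p * y2 + 2 * (1 + p * r) * (1 - p ^ 2) * hα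
  · simp only
    rw [eq_div_iff (by simp [n2, n3])]
    refine mul_left_cancel₀ hs ?_
    linear_combination r * y2 - 2 * (1 + p * r) * (1 - r ^ 2) * hα

/-! ### Solutions from products of elliptic integrals -/

/-- The moduli `k` for which both `K(k²)` and `K(1 - k²)` are off their branch cut. -/
def slitModuli : Set ℂ := {k | k ^ 2 ∈ Complex.slitPlane ∧ 1 - k ^ 2 ∈ Complex.slitPlane}

/-- `A` is a holomorphic solution, on the set of moduli `slitModuli`, of the differential equation
satisfied by the complete elliptic integral as a function of the modulus. -/
structure IsLegendreSolution (A : ℂ → ℂ) : Prop where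
  analytic : AnalyticOnNhd ℂ A slitModuli
  ode : ∀ k ∈ slitModuli,
    k * (1 - k ^ 2) * deriv (deriv A) k + (1 - 3 * k ^ 2) * deriv A k - k * A k = 0

theorem isOpen_slitModuli : IsOpen slitModuli :=
  (Complex.isOpen_slitPlane.preimage (by fun_prop)).inter
    (Complex.isOpen_slitPlane.preimage (f := fun k : ℂ => 1 - k ^ 2) (by fun_prop))

theorem IsLegendreSolution.comp_sq {f : ℂ → ℂ} (hf : ∀ m ∈ Complex.slitPlane,
    1 - m ∈ Complex.slitPlane → AnalyticAt ℂ f m ∧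
      m * (1 - m) * deriv (deriv f) m + (1 - 2 * m) * deriv f m - 1 / 4 * f m = 0) :
    IsLegendreSolution (fun k => f (k ^ 2)) := by
  have hsq : ∀ k : ℂ, HasDerivAt (fun k : ℂ => k ^ 2) (2 * k) k := fun k => by
    simpa using hasDerivAt_pow 2 k
  have h1 : ∀ k ∈ slitModuli, HasDerivAt (fun k => f (k ^ 2)) (deriv f (k ^ 2) * (2 * k)) k :=
    fun k hk => HasDerivAt.comp k
      (hf _ hk.1 hk.2).1.differentiableAt.hasDerivAt (hsq k)
  refine ⟨DifferentiableOn.analyticOnNhd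
    (fun k hk => (h1 k hk).differentiableAt.differentiableWithinAt) isOpen_slitModuli,
    fun k hk => ?_⟩
  have h2 : HasDerivAt (deriv fun k => f (k ^ 2))
      (deriv (deriv f) (k ^ 2) * (2 * k) * (2 * k) + deriv f (k ^ 2) * 2) k := by
    have h3 := HasDerivAt.comp k (hf _ hk.1 hk.2).1.deriv.differentiableAt.hasDerivAt (hsq k)
    have h4 := h3.mul ((hasDerivAt_id k).const_mul 2)
    rw [mul_one] at h4
    refine h4.congr_of_eventuallyEq ?_
    filter_upwards [isOpen_slitModuli.mem_nhds hk] with q hq using (h1 q hq).deriv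
  rw [h2.deriv, (h1 k hk).deriv]
  linear_combination 4 * k * (hf _ hk.1 hk.2).2

theorem isLegendreSolution_ellipticK : IsLegendreSolution (fun k => ellipticK (k ^ 2)) :=
  .comp_sq fun _ _ h => ⟨analyticAt_ellipticK h, ellipticK_ode h⟩

theorem isLegendreSolution_ellipticK_compl :
    IsLegendreSolution (fun k => ellipticK (1 - k ^ 2)) := by
  refine .comp_sq (f := fun m => ellipticK (1 - m)) fun m hm _ => ?_
  have hm' : 1 - (1 - m) ∈ Complex.slitPlane := by simpa using hm
  have e : deriv (fun m => ellipticK (1 - m)) = fun m => -deriv ellipticK (1 - m) := by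
    funext z
    exact deriv_comp_const_sub (f := ellipticK) 1 z
  refine ⟨(analyticAt_ellipticK hm').comp_of_eq (analyticAt_const.sub analyticAt_id) rfl, ?_⟩
  rw [e, deriv.fun_neg, deriv_comp_const_sub (f := deriv ellipticK) 1 m]
  linear_combination ellipticK_ode hm'

theorem slitLambdaRange_moduli {l : ℂ × ℂ} (hl : l ∈ slitLambdaRange) :
    l.1 ∈ slitModuli ∧ l.2 ∈ slitModuli := by
  refine ⟨⟨hl.2.1, ?_⟩, ⟨?_, hl.2.2⟩⟩
  · have := Complex.mem_slitPlane_of_norm_lt_one (z := -l.1 ^ 2) (by simpa using hl.1.1)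
    rwa [← sub_eq_add_neg] at this
  · have := Complex.mem_slitPlane_of_norm_lt_one (z := -(1 - l.2 ^ 2))
      (by rw [norm_neg]; exact hl.1.2.1)
    convert this using 1
    ring

theorem slitModuli_ne {k : ℂ} (hk : k ∈ slitModuli) : k ≠ 0 ∧ 1 - k ^ 2 ≠ 0 := by
  refine ⟨?_, Complex.slitPlane_ne_zero hk.2⟩
  rintro rfl
  simpa using Complex.slitPlane_ne_zero hk.1

/-- The function `(Λ₁ + Λ₂) A(Λ₁) B(Λ₂)`. -/
noncomputable def legendreProd (A B : ℂ → ℂ) (l : ℂ × ℂ) : ℂ := (l.1 + l.2) * A l.1 * B l.2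

/-- The derivative with respect to `x` of `legendreProd A B` composed with a branch of `(Λ₁, Λ₂)`,
expressed in the variables `(Λ₁, Λ₂)`. -/
noncomputable def legendreProdX (A B : ℂ → ℂ) (l : ℂ × ℂ) : ℂ :=
  (l.1 + l.2) ^ 3 * (A l.1 * B l.2 * (l.2 - l.1) +
    (1 - l.1 ^ 2) * deriv A l.1 * B l.2 - (1 - l.2 ^ 2) * A l.1 * deriv B l.2) /
    (4 * (l.2 - l.1) * (1 - l.1 * l.2))

/-- The derivative with respect to `y` of `legendreProd A B` composed with a branch of `(Λ₁, Λ₂)`,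
expressed in the variables `(Λ₁, Λ₂)`. -/
noncomputable def legendreProdY (A B : ℂ → ℂ) (l : ℂ × ℂ) : ℂ :=
  (l.1 + l.2) ^ 3 * (A l.1 * B l.2 + l.1 * deriv A l.1 * B l.2 + l.2 * A l.1 * deriv B l.2) /
    (2 * (1 + l.1 * l.2) * (1 - l.1 * l.2))

theorem IsLegendreSolution.hasDerivAt {A : ℂ → ℂ} (hA : IsLegendreSolution A) {k : ℂ}
    (hk : k ∈ slitModuli) : HasDerivAt A (deriv A k) k :=
  (hA.analytic k hk).differentiableAt.hasDerivAt

theorem IsLegendreSolution.hasDerivAt_deriv {A : ℂ → ℂ} (hA : IsLegendreSolution A) {k : ℂ}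
    (hk : k ∈ slitModuli) :
    HasDerivAt (deriv A) ((k * A k - (1 - 3 * k ^ 2) * deriv A k) / (k * (1 - k ^ 2))) k := by
  have h := (hA.analytic k hk).deriv.differentiableAt.hasDerivAt
  convert! h using 1
  obtain ⟨h1, h2⟩ := slitModuli_ne hk
  rw [div_eq_iff (mul_ne_zero h1 h2)]
  linear_combination -hA.ode k hk

theorem differentiableAt_legendre {A B : ℂ → ℂ} (hA : IsLegendreSolution A)
    (hB : IsLegendreSolution B) {l : ℂ × ℂ} (h1 : l.1 ∈ slitModuli) (h2 : l.2 ∈ slitModuli) :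
    (DifferentiableAt ℂ (fun l : ℂ × ℂ => A l.1) l ∧
      DifferentiableAt ℂ (fun l : ℂ × ℂ => deriv A l.1) l) ∧
    DifferentiableAt ℂ (fun l : ℂ × ℂ => B l.2) l ∧
      DifferentiableAt ℂ (fun l : ℂ × ℂ => deriv B l.2) l :=
  ⟨⟨(hA.hasDerivAt h1).differentiableAt.comp l differentiableAt_fst,
    (hA.hasDerivAt_deriv h1).differentiableAt.comp l differentiableAt_fst⟩,
    (hB.hasDerivAt h2).differentiableAt.comp l differentiableAt_snd,
    (hB.hasDerivAt_deriv h2).differentiableAt.comp l differentiableAt_snd⟩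

theorem legendreProd_partials {A B : ℂ → ℂ} (hA : IsLegendreSolution A)
    (hB : IsLegendreSolution B) {lam : ℂ × ℂ → ℂ × ℂ} {z : ℂ × ℂ} (hlam : DifferentiableAt ℂ lam z)
    (hinv : ∀ᶠ w in 𝓝 z, cdmT (lam w) = w) (hz : lam z ∈ slitLambdaRange) :
    partialX (fun w => legendreProd A B (lam w)) z = legendreProdX A B (lam z) ∧
    partialY (fun w => legendreProd A B (lam w)) z = legendreProdY A B (lam z) := by
  obtain ⟨hm1, hm2⟩ := slitLambdaRange_moduli hz
  obtain ⟨⟨n1, n2, n3⟩, eX, eY⟩ := lam_partials hlam hinv (p := (lam z).1) (r := (lam z).2) rfl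
    hz.1.2.2
  obtain ⟨⟨dA, dA'⟩, dB, dB'⟩ := differentiableAt_legendre hA hB hm1 hm2
  have hd : DifferentiableAt ℂ (legendreProd A B) (lam z) := by
    exact ((differentiableAt_fst.add differentiableAt_snd).mul dA).mul dB
  have h := partial_comp hd hlam
    ((((hasDerivAt_id (lam z).1).add_const (lam z).2).mul (hA.hasDerivAt hm1)).mul_const
      (B (lam z).2))
    ((((hasDerivAt_id (lam z).2).const_add (lam z).1).mul_const (A (lam z).1)).mul
      (hB.hasDerivAt hm2))
  refine ⟨(h (1, 0)).trans ?_, (h (0, 1)).trans ?_⟩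
  · rw [eX, legendreProdX]
    simp only [id]
    field_simp
    ring
  · rw [eY, legendreProdY]
    simp only [id]
    field_simp
    ring

/-- The second derivatives of `legendreProd A B` with respect to `x` and `y` satisfy the two
equations of the Appell system. -/
theorem legendreProd_equations {A B : ℂ → ℂ} (hA : IsLegendreSolution A)
    (hB : IsLegendreSolution B) {lam : ℂ × ℂ → ℂ × ℂ} {z : ℂ × ℂ} (hlam : DifferentiableAt ℂ lam z)
    (hinv : ∀ᶠ w in 𝓝 z, cdmT (lam w) = w) (hz : lam z ∈ slitLambdaRange) :
    z.1 * (1 - z.1) * partialX (fun w => legendreProdX A B (lam w)) z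
        - z.1 * z.2 * partialX (fun w => legendreProdY A B (lam w)) z
        + (1 - 2 * z.1) * legendreProdX A B (lam z) - 1 / 2 * z.2 * legendreProdY A B (lam z)
        - 1 / 4 * legendreProd A B (lam z) = 0 ∧
      z.2 * (1 - z.2) * partialY (fun w => legendreProdY A B (lam w)) z
        - z.1 * z.2 * partialX (fun w => legendreProdY A B (lam w)) z
        + (1 - 2 * z.2) * legendreProdY A B (lam z) - 1 / 2 * z.1 * legendreProdX A B (lam z)
        - 1 / 4 * legendreProd A B (lam z) = 0 := by
  obtain ⟨hm1, hm2⟩ := slitLambdaRange_moduli hz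
  obtain ⟨⟨n1, n2, n3⟩, eX, eY⟩ := lam_partials hlam hinv (p := (lam z).1) (r := (lam z).2) rfl
    hz.1.2.2
  obtain ⟨⟨dA, dA'⟩, dB, dB'⟩ := differentiableAt_legendre hA hB hm1 hm2
  have hn1 : 4 * ((lam z).2 - (lam z).1) * (1 - (lam z).1 * (lam z).2) ≠ 0 := by simp [n1, n2]
  have hn2 : 2 * (1 + (lam z).1 * (lam z).2) * (1 - (lam z).1 * (lam z).2) ≠ 0 := by
    simp [n3, n2]
  have hfst : DifferentiableAt ℂ (fun l : ℂ × ℂ => l.1) (lam z) := differentiableAt_fst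
  have hsnd : DifferentiableAt ℂ (fun l : ℂ × ℂ => l.2) (lam z) := differentiableAt_snd
  have hdX : DifferentiableAt ℂ (legendreProdX A B) (lam z) := by
    have hinv : DifferentiableAt ℂ (fun l : ℂ × ℂ => (4 * (l.2 - l.1) * (1 - l.1 * l.2))⁻¹)
        (lam z) :=
      DifferentiableAt.fun_inv (by fun_prop) hn1
    unfold legendreProdX
    simp only [div_eq_mul_inv]
    exact (((hfst.add hsnd).pow 3).mul ((((dA.mul dB).mul (hsnd.sub hfst)).add
      ((((hfst.pow 2).const_sub 1).mul dA').mul dB)).sub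
      ((((hsnd.pow 2).const_sub 1).mul dA).mul dB'))).mul hinv
  have hdY : DifferentiableAt ℂ (legendreProdY A B) (lam z) := by
    have hinv : DifferentiableAt ℂ (fun l : ℂ × ℂ => (2 * (1 + l.1 * l.2) * (1 - l.1 * l.2))⁻¹)
        (lam z) :=
      DifferentiableAt.fun_inv (by fun_prop) hn2
    unfold legendreProdY
    simp only [div_eq_mul_inv]
    exact (((hfst.add hsnd).pow 3).mul (((dA.mul dB).add ((hfst.mul dA').mul dB)).add
      ((hsnd.mul dA).mul dB'))).mul hinv
  have a0 := hA.hasDerivAt hm1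
  have a1 := hA.hasDerivAt_deriv hm1
  have b0 := hB.hasDerivAt hm2
  have b1 := hB.hasDerivAt_deriv hm2
  have idp := hasDerivAt_id (lam z).1
  have idr := hasDerivAt_id (lam z).2
  have hX := partial_comp hdX hlam
    ((((idp.add_const (lam z).2).pow 3).mul ((((a0.mul_const (B (lam z).2)).mul
      (idp.const_sub (lam z).2)).add ((((idp.pow 2).const_sub 1).mul a1).mul_const
      (B (lam z).2))).sub ((a0.const_mul (1 - (lam z).2 ^ 2)).mul_const (deriv B (lam z).2)))).div
      (((idp.const_sub (lam z).2).const_mul 4).mul ((idp.mul_const (lam z).2).const_sub 1)) hn1)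
    ((((idr.const_add (lam z).1).pow 3).mul ((((b0.const_mul (A (lam z).1)).mul
      (idr.sub_const (lam z).1)).add (b0.const_mul ((1 - (lam z).1 ^ 2) * deriv A (lam z).1))).sub
      ((((idr.pow 2).const_sub 1).mul_const (A (lam z).1)).mul b1))).div
      (((idr.sub_const (lam z).1).const_mul 4).mul ((idr.const_mul (lam z).1).const_sub 1)) hn1)
  have hY := partial_comp hdY hlam
    ((((idp.add_const (lam z).2).pow 3).mul (((a0.mul_const (B (lam z).2)).add
      ((idp.mul a1).mul_const (B (lam z).2))).add ((a0.const_mul (lam z).2).mul_const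
      (deriv B (lam z).2)))).div
      ((((idp.mul_const (lam z).2).const_add 1).const_mul 2).mul
        ((idp.mul_const (lam z).2).const_sub 1)) hn2)
    ((((idr.const_add (lam z).1).pow 3).mul (((b0.const_mul (A (lam z).1)).add
      (b0.const_mul ((lam z).1 * deriv A (lam z).1))).add
      ((idr.mul_const (A (lam z).1)).mul b1))).div
      ((((idr.const_mul (lam z).1).const_add 1).const_mul 2).mul
        ((idr.const_mul (lam z).1).const_sub 1)) hn2)
  have eXX : partialX (fun w => legendreProdX A B (lam w)) z = _ := hX (1, 0)
  have eXY : partialX (fun w => legendreProdY A B (lam w)) z = _ := hY (1, 0)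
  have eYY : partialY (fun w => legendreProdY A B (lam w)) z = _ := hY (0, 1)
  rw [eXX, eXY, eYY]
  constructor
  -- both equations are now identities of rational functions in `Λ₁`, `Λ₂`, bilinear in the values
  -- of `(A, A')` and `(B, B')`
  all_goals
    have hs : (lam z).1 + (lam z).2 ≠ 0 := hz.1.2.2
    obtain ⟨p0, p1⟩ := slitModuli_ne hm1
    obtain ⟨r0, r1⟩ := slitModuli_ne hm2
    have hzz := hinv.self_of_nhds
    have hz1 : z.1 = 4 * (lam z).1 * (lam z).2 / ((lam z).1 + (lam z).2) ^ 2 :=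
      congrArg Prod.fst hzz.symm
    have hz2 : z.2 =
        -((1 - (lam z).1 ^ 2) * (1 - (lam z).2 ^ 2)) / ((lam z).1 + (lam z).2) ^ 2 :=
      congrArg Prod.snd hzz.symm
    rw [eX, hz1, hz2, legendreProdX, legendreProdY, legendreProd]
    try rw [eY]
    simp only [id, Pi.add_apply, Pi.mul_apply, Pi.sub_apply, Pi.pow_apply]
    clear hX hY eXX eXY eYY hz1 hz2 hzz eX eY a0 a1 b0 b1 idp idr hdX hdY dA dA' dB dB'
      hinv hlam hz hm1 hm2
    generalize deriv A (lam z).1 = a' at *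
    generalize deriv B (lam z).2 = b' at *
    generalize A (lam z).1 = a at *
    generalize B (lam z).2 = b at *
    generalize (lam z).1 = p at *
    generalize (lam z).2 = r at *
    field_simp
    ring

/-- If `A` and `B` solve the differential equation of the elliptic integral, then
`(Λ₁ + Λ₂) A(Λ₁) B(Λ₂)` solves the Appell system in the variables `(x, y) = T(Λ₁, Λ₂)`. -/
theorem isAppellF2Solution_legendreProd {A B : ℂ → ℂ} (hA : IsLegendreSolution A)
    (hB : IsLegendreSolution B) {U : Set (ℂ × ℂ)} (hU : IsOpen U) {lam : ℂ × ℂ → ℂ × ℂ}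
    (hlam : IsLambdaBranch slitLambdaRange U lam) :
    IsAppellF2Solution (1 / 2) (1 / 2) (1 / 2) 1 1 U (fun z => legendreProd A B (lam z)) := by
  have hd : ∀ z ∈ U, DifferentiableAt ℂ lam z := fun z hz =>
    (hlam.holomorphic z hz).differentiableAt
  have hinv : ∀ z ∈ U, ∀ᶠ w in 𝓝 z, cdmT (lam w) = w := fun z hz =>
    (hU.eventually_mem hz).mono fun w hw => hlam.inverse w hw
  have h1 : ∀ z ∈ U, _ := fun z hz =>
    legendreProd_partials hA hB (hd z hz) (hinv z hz) (hlam.mem_range z hz)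
  have h2 : ∀ z ∈ U, _ := fun z hz =>
    legendreProd_equations hA hB (hd z hz) (hinv z hz) (hlam.mem_range z hz)
  have eX : ∀ z ∈ U, partialX (fun w => legendreProd A B (lam w)) =ᶠ[𝓝 z]
      fun w => legendreProdX A B (lam w) := fun z hz =>
    (hU.eventually_mem hz).mono fun w hw => (h1 w hw).1
  have eY : ∀ z ∈ U, partialY (fun w => legendreProd A B (lam w)) =ᶠ[𝓝 z]
      fun w => legendreProdY A B (lam w) := fun z hz =>
    (hU.eventually_mem hz).mono fun w hw => (h1 w hw).2
  refine ⟨fun z hz => ?_, fun x y hz => ?_, fun x y hz => ?_⟩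
  · obtain ⟨hm1, hm2⟩ := slitLambdaRange_moduli (hlam.mem_range z hz)
    have a1 : AnalyticAt ℂ (fun z => (lam z).1) z := analyticAt_fst.comp (hlam.holomorphic z hz)
    have a2 : AnalyticAt ℂ (fun z => (lam z).2) z := analyticAt_snd.comp (hlam.holomorphic z hz)
    exact ((a1.add a2).mul ((hA.analytic _ hm1).comp_of_eq a1 rfl)).mul
      ((hB.analytic _ hm2).comp_of_eq a2 rfl)
  · obtain ⟨e1, e2⟩ := h2 _ hz
    rw [(partial_congr (eX _ hz)).1, (partial_congr (eY _ hz)).1, (h1 _ hz).1, (h1 _ hz).2]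
    linear_combination e1
  · obtain ⟨e1, e2⟩ := h2 _ hz
    rw [(partial_congr (eY _ hz)).2, (partial_congr (eY _ hz)).1, (h1 _ hz).1, (h1 _ hz).2]
    linear_combination e2

/-! ### The rank of the Appell system -/

/-- The values at `q` of `F`, `∂F/∂x`, `∂F/∂y` and `∂²F/∂x∂y`. -/
noncomputable def jet (F : ℂ × ℂ → ℂ) (q : ℂ × ℂ) : Fin 4 → ℂ :=
  ![F q, partialX F q, partialY F q, partialX (partialY F) q]

/-- The complement of the singular locus of the Appell `F₂` system. -/
def regularLocus : Set (ℂ × ℂ) :=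
  {q | q.1 ≠ 0 ∧ q.2 ≠ 0 ∧ 1 - q.1 ≠ 0 ∧ 1 - q.2 ≠ 0 ∧ 1 - q.1 - q.2 ≠ 0}

theorem jet_analyticAt {F : ℂ × ℂ → ℂ} {p : ℂ × ℂ} (hF : AnalyticAt ℂ F p) (i : Fin 4) :
    AnalyticAt ℂ (fun q => jet F q i) p := by
  fin_cases i
  · exact hF
  · exact partialX_analyticAt hF
  · exact partialY_analyticAt hF
  · exact partialX_analyticAt (partialY_analyticAt hF)

theorem jet_congr {F G : ℂ × ℂ → ℂ} {p : ℂ × ℂ} (h : F =ᶠ[𝓝 p] G) : jet F p = jet G p := by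
  have h' : partialY F =ᶠ[𝓝 p] partialY G := by
    filter_upwards [h.eventually_nhds] with q hq using (partial_congr hq).2
  simp [jet, h.self_of_nhds, (partial_congr h).1, (partial_congr h).2, (partial_congr h').1]

theorem jet_smul_add {F G : ℂ × ℂ → ℂ} {p : ℂ × ℂ} (c : ℂ) (hF : AnalyticAt ℂ F p)
    (hG : AnalyticAt ℂ G p) : jet (fun q => c * F q + G q) p = c • jet F p + jet G p := by
  have eY : partialY (fun q => c * F q + G q) =ᶠ[𝓝 p] fun q => c * partialY F q + partialY G q := by
    filter_upwards [hF.eventually_analyticAt, hG.eventually_analyticAt] with r h1 h2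
      using (partial_smul_add c h1 h2).2
  simp [jet, (partial_smul_add c hF hG).1, (partial_smul_add c hF hG).2, (partial_congr eY).1,
    (partial_smul_add c (partialY_analyticAt hF) (partialY_analyticAt hG)).1]

/-- A function whose derivative is bounded by a multiple of the function vanishes near each of its
zeros (Grönwall's inequality along segments). -/
theorem eventually_eq_zero_of_norm_fderiv_le {E F : Type*} [NormedAddCommGroup E]
    [NormedSpace ℂ E] [NormedAddCommGroup F] [NormedSpace ℂ F] {V : E → F} {p : E} {C : ℝ}
    (hV : ∀ᶠ q in 𝓝 p, DifferentiableAt ℂ V q ∧ ‖fderiv ℂ V q‖ ≤ C * ‖V q‖) (hp : V p = 0) :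
    ∀ᶠ q in 𝓝 p, V q = 0 := by
  let : NormedSpace ℝ E := NormedSpace.restrictScalars ℝ ℂ E
  let : NormedSpace ℝ F := NormedSpace.restrictScalars ℝ ℂ F
  obtain ⟨ε, hε, hball⟩ := Metric.eventually_nhds_iff_ball.1 hV
  filter_upwards [Metric.ball_mem_nhds p hε] with q hq
  have hmem : ∀ t ∈ Icc (0 : ℝ) 1, p + (t : ℂ) • (q - p) ∈ Metric.ball p ε := by
    intro t ht
    rw [mem_ball_iff_norm] at hq ⊢
    rw [add_sub_cancel_left, norm_smul, Complex.norm_real, Real.norm_of_nonneg ht.1]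
    exact (mul_le_of_le_one_left (norm_nonneg _) ht.2).trans_lt hq
  have hd : ∀ t ∈ Icc (0 : ℝ) 1, HasDerivAt (fun t : ℝ => V (p + (t : ℂ) • (q - p)))
      (fderiv ℂ V (p + (t : ℂ) • (q - p)) (q - p)) t := by
    intro t ht
    have h1 : HasDerivAt (fun t : ℝ => p + (t : ℂ) • (q - p)) (q - p) t := by
      simpa using ((Complex.ofRealCLM.hasDerivAt (x := t)).smul_const (q - p)).const_add p
    exact ((hball _ (hmem t ht)).1.hasFDerivAt.restrictScalars ℝ).comp_hasDerivAt t h1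
  have := eq_zero_of_abs_deriv_le_mul_abs_self_of_eq_zero_right (K := C * ‖q - p‖)
    (f := fun t : ℝ => V (p + (t : ℂ) • (q - p))) (a := 0) (b := 1)
    (fun t ht => (hd t ht).continuousAt.continuousWithinAt)
    (fun t ht => (hd t (Ico_subset_Icc_self ht)).hasDerivWithinAt) (by simpa using hp)
    (fun t ht => by
      refine (ContinuousLinearMap.le_opNorm _ _).trans ?_
      have := (hball _ (hmem t (Ico_subset_Icc_self ht))).2
      nlinarith [norm_nonneg (q - p)]) 1 (right_mem_Icc.2 zero_le_one)
  simpa using this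

section

variable {F : ℂ × ℂ → ℂ} {U : Set (ℂ × ℂ)}

/-- The equation in `x`, differentiated with respect to `y`. -/
theorem eqX_partialY (hU : IsOpen U) (hF : IsAppellF2Solution (1 / 2) (1 / 2) (1 / 2) 1 1 U F)
    {x y : ℂ} (h : (x, y) ∈ U) :
    x * (1 - x) * partialX (partialX (partialY F)) (x, y)
      - x * y * partialY (partialX (partialY F)) (x, y) + (1 - 3 * x) * partialX (partialY F) (x, y)
      - 1 / 2 * y * partialY (partialY F) (x, y) - 3 / 4 * partialY F (x, y) = 0 := by
  have a := hF.holomorphic _ h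
  have aX := partialX_analyticAt a
  have aY := partialY_analyticAt a
  have hcomm : partialY (partialX F) =ᶠ[𝓝 (x, y)] partialX (partialY F) := by
    filter_upwards [a.eventually_analyticAt] with q hq using partialY_partialX hq
  have hev : ∀ᶠ y' in 𝓝 y, (x, y') ∈ U :=
    (by fun_prop : Continuous fun y' : ℂ => (x, y')).continuousAt.eventually (hU.mem_nhds h)
  have id := hasDerivAt_id y
  have hd := (((((hasDerivAt_partialY (partialX_analyticAt aX).differentiableAt).const_mul
    (x * (1 - x))).sub ((id.const_mul x).mul
    (hasDerivAt_partialY (partialX_analyticAt aY).differentiableAt))).add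
    ((hasDerivAt_partialY aX.differentiableAt).const_mul (1 - (1 / 2 + 1 / 2 + 1) * x))).sub
    ((id.const_mul (1 / 2)).mul (hasDerivAt_partialY aY.differentiableAt))).sub
    ((hasDerivAt_partialY a.differentiableAt).const_mul (1 / 2 * (1 / 2)))
  have := hd.unique ((hasDerivAt_const y (0 : ℂ)).congr_of_eventuallyEq
    (hev.mono fun y' hy' => hF.eqX x y' hy'))
  rw [partialY_partialX aX, (partial_congr hcomm).1, partialY_partialX a] at this
  simp only [_root_.id] at this
  linear_combination this

/-- The equation in `y`, differentiated with respect to `x`. -/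
theorem eqY_partialX (hU : IsOpen U) (hF : IsAppellF2Solution (1 / 2) (1 / 2) (1 / 2) 1 1 U F)
    {x y : ℂ} (h : (x, y) ∈ U) :
    y * (1 - y) * partialY (partialX (partialY F)) (x, y)
      - x * y * partialX (partialX (partialY F)) (x, y) + (1 - 3 * y) * partialX (partialY F) (x, y)
      - 1 / 2 * x * partialX (partialX F) (x, y) - 3 / 4 * partialX F (x, y) = 0 := by
  have a := hF.holomorphic _ h
  have aX := partialX_analyticAt a
  have aY := partialY_analyticAt a
  have hev : ∀ᶠ x' in 𝓝 x, (x', y) ∈ U :=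
    (by fun_prop : Continuous fun x' : ℂ => (x', y)).continuousAt.eventually (hU.mem_nhds h)
  have id := hasDerivAt_id x
  have hd := (((((hasDerivAt_partialX (partialY_analyticAt aY).differentiableAt).const_mul
    (y * (1 - y))).sub ((id.mul_const y).mul
    (hasDerivAt_partialX (partialX_analyticAt aY).differentiableAt))).add
    ((hasDerivAt_partialX aY.differentiableAt).const_mul (1 - (1 / 2 + 1 / 2 + 1) * y))).sub
    ((id.const_mul (1 / 2)).mul (hasDerivAt_partialX aX.differentiableAt))).sub
    ((hasDerivAt_partialX a.differentiableAt).const_mul (1 / 2 * (1 / 2)))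
  have := hd.unique ((hasDerivAt_const x (0 : ℂ)).congr_of_eventuallyEq
    (hev.mono fun x' hx' => hF.eqY x' y hx'))
  rw [← partialY_partialX aY] at this
  simp only [_root_.id] at this
  linear_combination this

end

theorem isBigO_continuous_mul {E : Type*} [NormedAddCommGroup E] {c f : ℂ × ℂ → ℂ}
    {V : ℂ × ℂ → E} {p : ℂ × ℂ} (hc : ContinuousAt c p) (hf : f =O[𝓝 p] V) :
    (fun q => c q * f q) =O[𝓝 p] V := by
  simpa using (hc.tendsto.isBigO_one ℝ).mul hf.norm_right

/-- Near a regular point the system and the two differentiated equations express the derivatives of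
the entries of the jet through these entries: after division by `x (1 - x)` and `y (1 - y)`, and by
the determinant `x y (1 - x - y)` of the differentiated equations. -/
theorem jet_partials_isBigO {F : ℂ × ℂ → ℂ} {U : Set (ℂ × ℂ)} (hU : IsOpen U)
    (hF : IsAppellF2Solution (1 / 2) (1 / 2) (1 / 2) 1 1 U F) {p : ℂ × ℂ} (hp : p ∈ U)
    (hreg : p ∈ regularLocus) (i : Fin 4) :
    partialX (fun q => jet F q i) =O[𝓝 p] jet F ∧ partialY (fun q => jet F q i) =O[𝓝 p] jet F := by
  have hj : ∀ i, (fun q => jet F q i) =O[𝓝 p] jet F := fun i =>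
    Asymptotics.isBigO_of_le _ fun q => norm_le_pi_norm (jet F q) i
  have o0 : F =O[𝓝 p] jet F := hj 0
  have oX : partialX F =O[𝓝 p] jet F := hj 1
  have oY : partialY F =O[𝓝 p] jet F := hj 2
  have oXY : partialX (partialY F) =O[𝓝 p] jet F := hj 3
  obtain ⟨hx, hy, hx1, hy1, hxy⟩ := hreg
  have ev : ∀ᶠ q in 𝓝 p, q ∈ U ∧ q ∈ regularLocus := by
    refine (hU.eventually_mem hp).and ?_
    have c1 : ContinuousAt (fun q : ℂ × ℂ => q.1) p := by fun_prop
    have c2 : ContinuousAt (fun q : ℂ × ℂ => q.2) p := by fun_prop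
    have c3 : ContinuousAt (fun q : ℂ × ℂ => 1 - q.1) p := by fun_prop
    have c4 : ContinuousAt (fun q : ℂ × ℂ => 1 - q.2) p := by fun_prop
    have c5 : ContinuousAt (fun q : ℂ × ℂ => 1 - q.1 - q.2) p := by fun_prop
    filter_upwards [c1.eventually_ne hx, c2.eventually_ne hy, c3.eventually_ne hx1,
      c4.eventually_ne hy1, c5.eventually_ne hxy] with q h1 h2 h3 h4 h5 using ⟨h1, h2, h3, h4, h5⟩
  have n1 : p.1 * (1 - p.1) ≠ 0 := mul_ne_zero hx hx1
  have n2 : p.2 * (1 - p.2) ≠ 0 := mul_ne_zero hy hy1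
  have n3 : p.1 * p.2 * (1 - p.1 - p.2) ≠ 0 := mul_ne_zero (mul_ne_zero hx hy) hxy
  have k1 : ContinuousAt (fun q : ℂ × ℂ => (q.1 * (1 - q.1))⁻¹) p :=
    ContinuousAt.inv₀ (by fun_prop) n1
  have k2 : ContinuousAt (fun q : ℂ × ℂ => (q.2 * (1 - q.2))⁻¹) p :=
    ContinuousAt.inv₀ (by fun_prop) n2
  have k3 : ContinuousAt (fun q : ℂ × ℂ => (q.1 * q.2 * (1 - q.1 - q.2))⁻¹) p :=
    ContinuousAt.inv₀ (by fun_prop) n3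
  have mul : ∀ {c f : ℂ × ℂ → ℂ}, ContinuousAt c p → f =O[𝓝 p] jet F →
      (fun q => c q * f q) =O[𝓝 p] jet F := fun hc hf => isBigO_continuous_mul hc hf
  have oXX : partialX (partialX F) =O[𝓝 p] jet F := by
    refine (mul k1 ((((mul (c := fun q => q.1 * q.2) (by fun_prop) oXY).sub
      (mul (c := fun q => 1 - 2 * q.1) (by fun_prop) oX)).add
      (mul (c := fun q => 1 / 2 * q.2) (by fun_prop) oY)).add
      (mul (c := fun _ => 1 / 4) (by fun_prop) o0))).congr' ?_ EventuallyEq.rfl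
    filter_upwards [ev] with q hq
    rw [inv_mul_eq_iff_eq_mul₀ (mul_ne_zero hq.2.1 hq.2.2.2.1)]
    linear_combination -hF.eqX q.1 q.2 hq.1
  have oYY : partialY (partialY F) =O[𝓝 p] jet F := by
    refine (mul k2 ((((mul (c := fun q => q.1 * q.2) (by fun_prop) oXY).sub
      (mul (c := fun q => 1 - 2 * q.2) (by fun_prop) oY)).add
      (mul (c := fun q => 1 / 2 * q.1) (by fun_prop) oX)).add
      (mul (c := fun _ => 1 / 4) (by fun_prop) o0))).congr' ?_ EventuallyEq.rfl
    filter_upwards [ev] with q hq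
    rw [inv_mul_eq_iff_eq_mul₀ (mul_ne_zero hq.2.2.1 hq.2.2.2.2.1)]
    linear_combination -hF.eqY q.1 q.2 hq.1
  -- the right-hand sides of the two differentiated equations
  have oR : (fun q => 1 / 2 * q.2 * partialY (partialY F) q + 3 / 4 * partialY F q -
      (1 - 3 * q.1) * partialX (partialY F) q) =O[𝓝 p] jet F :=
    ((mul (c := fun q => 1 / 2 * q.2) (by fun_prop) oYY).add
      (mul (c := fun _ => 3 / 4) (by fun_prop) oY)).sub
      (mul (c := fun q => 1 - 3 * q.1) (by fun_prop) oXY)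
  have oS : (fun q => 1 / 2 * q.1 * partialX (partialX F) q + 3 / 4 * partialX F q -
      (1 - 3 * q.2) * partialX (partialY F) q) =O[𝓝 p] jet F :=
    ((mul (c := fun q => 1 / 2 * q.1) (by fun_prop) oXX).add
      (mul (c := fun _ => 3 / 4) (by fun_prop) oX)).sub
      (mul (c := fun q => 1 - 3 * q.2) (by fun_prop) oXY)
  have oXXY : partialX (partialX (partialY F)) =O[𝓝 p] jet F := by
    refine (mul k3 ((mul (c := fun q => q.2 * (1 - q.2)) (by fun_prop) oR).add
      (mul (c := fun q => q.1 * q.2) (by fun_prop) oS))).congr' ?_ EventuallyEq.rfl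
    filter_upwards [ev] with q hq
    rw [inv_mul_eq_iff_eq_mul₀ (mul_ne_zero (mul_ne_zero hq.2.1 hq.2.2.1) hq.2.2.2.2.2)]
    linear_combination -(q.2 * (1 - q.2)) * eqX_partialY hU hF hq.1
      - q.1 * q.2 * eqY_partialX hU hF hq.1
  have oYXY : partialY (partialX (partialY F)) =O[𝓝 p] jet F := by
    refine (mul k3 ((mul (c := fun q => q.1 * q.2) (by fun_prop) oR).add
      (mul (c := fun q => q.1 * (1 - q.1)) (by fun_prop) oS))).congr' ?_ EventuallyEq.rfl
    filter_upwards [ev] with q hq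
    rw [inv_mul_eq_iff_eq_mul₀ (mul_ne_zero (mul_ne_zero hq.2.1 hq.2.2.1) hq.2.2.2.2.2)]
    linear_combination -(q.1 * q.2) * eqX_partialY hU hF hq.1
      - q.1 * (1 - q.1) * eqY_partialX hU hF hq.1
  fin_cases i
  · exact ⟨oX, oY⟩
  · refine ⟨oXX, oXY.congr' ?_ EventuallyEq.rfl⟩
    filter_upwards [ev] with q hq using (partialY_partialX (hF.holomorphic q hq.1)).symm
  · exact ⟨oXY, oYY⟩
  · exact ⟨oXXY, oYXY⟩

/-- A solution on a connected open set is determined by its jet at a regular point. -/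
theorem eqOn_zero_of_jet_eq_zero {F : ℂ × ℂ → ℂ} {U : Set (ℂ × ℂ)} (hU : IsOpen U)
    (hconn : IsPreconnected U) (hF : IsAppellF2Solution (1 / 2) (1 / 2) (1 / 2) 1 1 U F)
    {p : ℂ × ℂ} (hp : p ∈ U) (hreg : p ∈ regularLocus) (h0 : jet F p = 0) : EqOn F 0 U := by
  have hb := fun i => jet_partials_isBigO hU hF hp hreg i
  choose c hc using fun i => (hb i).1.bound
  choose d hd using fun i => (hb i).2.bound
  have key : ∀ᶠ q in 𝓝 p, DifferentiableAt ℂ (jet F) q ∧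
      ‖fderiv ℂ (jet F) q‖ ≤ (∑ i, (|c i| + |d i|)) * ‖jet F q‖ := by
    filter_upwards [hU.eventually_mem hp, eventually_all.2 hc, eventually_all.2 hd] with q hq h1 h2
    have hdiff : ∀ i, DifferentiableAt ℂ (fun q => jet F q i) q := fun i =>
      (jet_analyticAt (hF.holomorphic q hq) i).differentiableAt
    refine ⟨differentiableAt_pi.2 hdiff, ContinuousLinearMap.opNorm_le_bound _ (by positivity)
      fun v => (pi_norm_le_iff_of_nonneg (by positivity)).2 fun i => ?_⟩
    have e : fderiv ℂ (jet F) q v i = fderiv ℂ (fun q => jet F q i) q v := by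
      rw [fderiv_pi hdiff]; rfl
    rw [e, fderiv_apply_eq_partial]
    have hi : |c i| + |d i| ≤ ∑ i, (|c i| + |d i|) :=
      Finset.single_le_sum (f := fun i => |c i| + |d i|) (fun _ _ => by positivity)
        (Finset.mem_univ i)
    calc ‖v.1 * partialX (fun q => jet F q i) q + v.2 * partialY (fun q => jet F q i) q‖
        ≤ ‖v.1‖ * ‖partialX (fun q => jet F q i) q‖ +
          ‖v.2‖ * ‖partialY (fun q => jet F q i) q‖ := by
          refine (norm_add_le _ _).trans ?_
          rw [norm_mul, norm_mul]
      _ ≤ ‖v‖ * (|c i| * ‖jet F q‖) + ‖v‖ * (|d i| * ‖jet F q‖) := by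
          gcongr
          · exact norm_fst_le v
          · exact (h1 i).trans (by gcongr; exact le_abs_self _)
          · exact norm_snd_le v
          · exact (h2 i).trans (by gcongr; exact le_abs_self _)
      _ = (|c i| + |d i|) * ‖jet F q‖ * ‖v‖ := by ring
      _ ≤ _ := by gcongr
  have hz := eventually_eq_zero_of_norm_fderiv_le key h0
  exact hF.holomorphic.eqOn_zero_of_preconnected_of_eventuallyEq_zero hconn hp
    (hz.mono fun q hq => congrFun hq 0)

/-- The extension by zero of a function on `U`. -/
noncomputable def extendZero (U : Set (ℂ × ℂ)) (f : U → ℂ) : ℂ × ℂ → ℂ :=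
  Function.extend Subtype.val f 0

theorem extendZero_eqOn {U : Set (ℂ × ℂ)} {f : U → ℂ} {F : ℂ × ℂ → ℂ} (h : ∀ p : U, f p = F p) :
    EqOn (extendZero U f) F U := fun q hq => by
  rw [← h ⟨q, hq⟩]
  exact Subtype.val_injective.extend_apply f 0 ⟨q, hq⟩

theorem IsAppellF2Solution.congr {α β₁ β₂ γ₁ γ₂ : ℂ} {U : Set (ℂ × ℂ)} {F G : ℂ × ℂ → ℂ}
    (hF : IsAppellF2Solution α β₁ β₂ γ₁ γ₂ U F) (hU : IsOpen U) (h : EqOn F G U) :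
    IsAppellF2Solution α β₁ β₂ γ₁ γ₂ U G := by
  have e : ∀ p ∈ U, F =ᶠ[𝓝 p] G := fun p hp => h.eventuallyEq_of_mem (hU.mem_nhds hp)
  have eX : ∀ p ∈ U, partialX F =ᶠ[𝓝 p] partialX G := fun p hp =>
    (hU.eventually_mem hp).mono fun q hq => (partial_congr (e q hq)).1
  have eY : ∀ p ∈ U, partialY F =ᶠ[𝓝 p] partialY G := fun p hp =>
    (hU.eventually_mem hp).mono fun q hq => (partial_congr (e q hq)).2
  refine ⟨fun p hp => (hF.holomorphic p hp).congr (e p hp), fun x y hp => ?_, fun x y hp => ?_⟩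
  · rw [← (partial_congr (eX _ hp)).1, ← (partial_congr (eY _ hp)).1, ← (eX _ hp).self_of_nhds,
      ← (eY _ hp).self_of_nhds, ← h hp]
    exact hF.eqX x y hp
  · rw [← (partial_congr (eY _ hp)).2, ← (partial_congr (eY _ hp)).1, ← (eX _ hp).self_of_nhds,
      ← (eY _ hp).self_of_nhds, ← h hp]
    exact hF.eqY x y hp

theorem isAppellF2Solution_extendZero {α β₁ β₂ γ₁ γ₂ : ℂ} {U : Set (ℂ × ℂ)} (hU : IsOpen U)
    (f : appellF2Solutions α β₁ β₂ γ₁ γ₂ U) :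
    IsAppellF2Solution α β₁ β₂ γ₁ γ₂ U (extendZero U f) := by
  obtain ⟨F, hF, hf⟩ := f.2
  exact hF.congr hU (extendZero_eqOn hf).symm

/-- The jet at a point, as a linear map on the space of solutions. -/
noncomputable def jetLinear {U : Set (ℂ × ℂ)} (hU : IsOpen U) {p : ℂ × ℂ} (hp : p ∈ U) :
    traintrackSolutions U →ₗ[ℂ] (Fin 4 → ℂ) where
  toFun f := jet (extendZero U f) p
  map_add' f g := by
    have hf := (isAppellF2Solution_extendZero hU f).holomorphic p hp
    have hg := (isAppellF2Solution_extendZero hU g).holomorphic p hp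
    have := jet_smul_add 1 hf hg
    rw [one_smul] at this
    rw [← this]
    refine jet_congr ((extendZero_eqOn fun q => ?_).eventuallyEq_of_mem (hU.mem_nhds hp))
    simp [extendZero]
  map_smul' c f := by
    have hf := (isAppellF2Solution_extendZero hU f).holomorphic p hp
    have := jet_smul_add c hf (analyticAt_const (v := (0 : ℂ)))
    have h0 : jet (fun _ => (0 : ℂ)) p = 0 := by
      simpa using! jet_smul_add (p := p) (-1) (analyticAt_const (v := (0 : ℂ)))
        (analyticAt_const (v := (0 : ℂ)))
    rw [h0, add_zero] at this
    rw [RingHom.id_apply, ← this]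
    refine jet_congr ((extendZero_eqOn fun q => ?_).eventuallyEq_of_mem (hU.mem_nhds hp))
    simp [extendZero]

theorem jetLinear_injective {U : Set (ℂ × ℂ)} (hU : IsOpen U) (hconn : IsPreconnected U)
    {p : ℂ × ℂ} (hp : p ∈ U) (hreg : p ∈ regularLocus) :
    Function.Injective (jetLinear hU hp) := by
  rw [← LinearMap.ker_eq_bot, LinearMap.ker_eq_bot']
  intro f hf
  have h := eqOn_zero_of_jet_eq_zero hU hconn (isAppellF2Solution_extendZero hU f) hp hreg hf
  ext q
  have := h q.2
  rwa [extendZero, Subtype.val_injective.extend_apply] at this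

/-- The rank is at most four, so four independent solutions form a basis. -/
theorem isSolutionBasis_of_independent {U : Set (ℂ × ℂ)} (hU : IsOpen U) (hconn : IsPreconnected U)
    {p : ℂ × ℂ} (hp : p ∈ U) (hreg : p ∈ regularLocus) {P : ℂ × ℂ → Fin 4 → ℂ}
    (hP : ∀ i, IsAppellF2Solution (1 / 2) (1 / 2) (1 / 2) 1 1 U fun q => P q i)
    (hind : ∀ c : Fin 4 → ℂ, (∀ q ∈ U, ∑ i, c i * P q i = 0) → c = 0) : IsSolutionBasis U P := by
  let b : Fin 4 → traintrackSolutions U := fun i => ⟨fun q => P q i, _, hP i, fun _ => rfl⟩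
  have hb : LinearIndependent ℂ b := by
    rw [Fintype.linearIndependent_iff]
    intro c hc
    refine congrFun (hind c fun q hq => ?_)
    have := congrArg (fun f : traintrackSolutions U => (f : U → ℂ) ⟨q, hq⟩) hc
    simpa [b] using this
  have hinj := jetLinear_injective hU hconn hp hreg
  have : Module.Finite ℂ (traintrackSolutions U) := Module.Finite.of_injective _ hinj
  have hle : Module.finrank ℂ (traintrackSolutions U) ≤ 4 := by
    simpa using LinearMap.finrank_le_finrank_of_injective hinj
  have hge : 4 ≤ Module.finrank ℂ (traintrackSolutions U) := by
    simpa using hb.fintype_card_le_finrank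
  refine ⟨basisOfLinearIndependentOfCardEqFinrank hb (by simpa using hge.antisymm hle),
    fun i q => ?_⟩
  simp [b]

/-! ### The basis of products -/

theorem cdmT_regular {l : ℂ × ℂ} (hs : l.1 + l.2 ≠ 0) (h1 : l.1 ∈ slitModuli)
    (h2 : l.2 ∈ slitModuli) (n1 : l.2 - l.1 ≠ 0) (n2 : 1 - l.1 * l.2 ≠ 0)
    (n3 : 1 + l.1 * l.2 ≠ 0) : cdmT l ∈ regularLocus := by
  obtain ⟨p0, p1⟩ := slitModuli_ne h1
  obtain ⟨r0, r1⟩ := slitModuli_ne h2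
  have e3 : 1 - (cdmT l).1 = ((l.2 - l.1) / (l.1 + l.2)) ^ 2 := by
    simp only [cdmT]; field_simp; ring
  have e4 : 1 - (cdmT l).2 = ((1 + l.1 * l.2) / (l.1 + l.2)) ^ 2 := by
    simp only [cdmT]; field_simp; ring
  have e5 : 1 - (cdmT l).1 - (cdmT l).2 = ((1 - l.1 * l.2) / (l.1 + l.2)) ^ 2 := by
    simp only [cdmT]; field_simp; ring
  refine ⟨?_, ?_, ?_, ?_, ?_⟩
  · simp [cdmT, p0, r0, hs]
  · simp [cdmT, p1, r1, hs]
  · rw [e3]; simp [n1, hs]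
  · rw [e4]; simp [n3, hs]
  · rw [e5]; simp [n2, hs]

/-- A holomorphic right inverse of `T` is a local homeomorphism. -/
theorem map_nhds_lam {lam : ℂ × ℂ → ℂ × ℂ} {z : ℂ × ℂ} (hlam : AnalyticAt ℂ lam z)
    (hinv : ∀ᶠ w in 𝓝 z, cdmT (lam w) = w) (hs : (lam z).1 + (lam z).2 ≠ 0) :
    map lam (𝓝 z) = 𝓝 (lam z) := by
  refine hlam.hasStrictFDerivAt.map_nhds_eq_of_surj (LinearMap.range_eq_top.2 ?_)
  refine LinearMap.injective_iff_surjective.1 ((injective_iff_map_eq_zero _).2 fun v hv => ?_)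
  have hv' : fderiv ℂ lam z v = 0 := hv
  obtain ⟨h1, h2⟩ := cdmT_tangent hlam.differentiableAt hinv hs v
  rw [hv'] at h1 h2
  simp only [Prod.fst_zero, Prod.snd_zero, mul_zero, sub_zero, add_zero] at h1 h2
  have hs3 := pow_ne_zero 3 hs
  exact Prod.ext ((mul_eq_zero.1 h1.symm).resolve_right hs3)
    ((mul_eq_zero.1 h2.symm).resolve_right hs3)

theorem eventually_sq {k : ℂ} (hk : k ≠ 0) {q : ℂ → Prop} (h : ∀ᶠ r in 𝓝 k, q (r ^ 2)) :
    ∀ᶠ m in 𝓝 (k ^ 2), q m := by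
  have hd : HasStrictDerivAt (fun k : ℂ => k ^ 2) (2 * k) k := by
    simpa using hasStrictDerivAt_pow 2 k
  rw [← hd.map_nhds_eq (mul_ne_zero two_ne_zero hk)]
  exact h

theorem ellipticK_sq_independent {a b k : ℂ} (hk : k ∈ slitModuli)
    (h : ∀ᶠ r in 𝓝 k, a * ellipticK (r ^ 2) + b * ellipticK (1 - r ^ 2) = 0) : a = 0 ∧ b = 0 :=
  ellipticK_independent hk.1 hk.2
    (eventually_sq (q := fun m => a * ellipticK m + b * ellipticK (1 - m) = 0)
      (slitModuli_ne hk).1 h)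

/-- The four products are linearly independent near any point: independence of `K(m)` and
`K(1 - m)` is applied in each of the two variables. -/
theorem ellipticProduct_independent {l : ℂ × ℂ} (hl : l ∈ slitLambdaRange) {c : Fin 4 → ℂ}
    (h : ∀ᶠ w in 𝓝 l, ∑ i, c i * ellipticProduct w i = 0) : c = 0 := by
  obtain ⟨h1, h2⟩ := slitLambdaRange_moduli hl
  have hs : ∀ᶠ w : ℂ × ℂ in 𝓝 l, w.1 + w.2 ≠ 0 :=
    (by fun_prop : ContinuousAt (fun w : ℂ × ℂ => w.1 + w.2) l).eventually_ne hl.1.2.2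
  have hpi : (Real.pi : ℂ) ≠ 0 := by exact_mod_cast Real.pi_ne_zero
  have hprod : ∀ᶠ w in 𝓝 l,
      (c 2 * Complex.I * ellipticK (w.1 ^ 2) + c 3 * Complex.I ^ 2 * ellipticK (1 - w.1 ^ 2)) *
        ellipticK (w.2 ^ 2) +
      (c 0 * ellipticK (w.1 ^ 2) + c 1 * Complex.I * ellipticK (1 - w.1 ^ 2)) *
        ellipticK (1 - w.2 ^ 2) = 0 := by
    filter_upwards [h, hs] with w hw hsw
    rw [Fin.sum_univ_four] at hw
    simp only [ellipticProduct, Matrix.cons_val] at hw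
    have hne : 4 / (Real.pi : ℂ) ^ 2 * (w.1 + w.2) ≠ 0 :=
      mul_ne_zero (div_ne_zero (by norm_num) (pow_ne_zero 2 hpi)) hsw
    refine (mul_eq_zero.1 ?_).resolve_left hne
    linear_combination hw
  rw [← Prod.mk.eta (p := l), nhds_prod_eq] at hprod
  have hcurry := hprod.curry.mono fun p hp => ellipticK_sq_independent
    (a := c 2 * Complex.I * ellipticK (p ^ 2) + c 3 * Complex.I ^ 2 * ellipticK (1 - p ^ 2))
    (b := c 0 * ellipticK (p ^ 2) + c 1 * Complex.I * ellipticK (1 - p ^ 2)) h2 hp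
  obtain ⟨e2, e3⟩ := ellipticK_sq_independent h1 (hcurry.mono fun p hp => hp.1)
  obtain ⟨e0, e1⟩ := ellipticK_sq_independent h1 (hcurry.mono fun p hp => hp.2)
  have hI := Complex.I_ne_zero
  ext i
  fin_cases i
  · exact e0
  · exact (mul_eq_zero.1 e1).resolve_right hI
  · exact (mul_eq_zero.1 e2).resolve_right hI
  · exact (mul_eq_zero.1 e3).resolve_right (pow_ne_zero 2 hI)

theorem isAppellF2Solution_ellipticProduct {U : Set (ℂ × ℂ)} (hU : IsOpen U)
    {lam : ℂ × ℂ → ℂ × ℂ} (hlam : IsLambdaBranch slitLambdaRange U lam) (i : Fin 4) :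
    IsAppellF2Solution (1 / 2) (1 / 2) (1 / 2) 1 1 U fun q => ellipticProduct (lam q) i := by
  have key : ∀ (d : ℂ) {A B : ℂ → ℂ}, IsLegendreSolution A → IsLegendreSolution B →
      IsAppellF2Solution (1 / 2) (1 / 2) (1 / 2) 1 1 U
        fun q => d * legendreProd A B (lam q) + 0 := fun d A B hA hB =>
    (isAppellF2Solution_legendreProd hA hB hU hlam).smul_add d (.zero ..)
  have k0 := isLegendreSolution_ellipticK
  have k1 := isLegendreSolution_ellipticK_compl
  fin_cases i
  · refine (key (4 / (Real.pi : ℂ) ^ 2) k0 k1).congr hU fun q _ => ?_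
    simp [ellipticProduct, legendreProd, mul_assoc]
  · refine (key (4 * Complex.I / (Real.pi : ℂ) ^ 2) k1 k1).congr hU fun q _ => ?_
    simp [ellipticProduct, legendreProd, mul_assoc]
  · refine (key (4 * Complex.I / (Real.pi : ℂ) ^ 2) k0 k0).congr hU fun q _ => ?_
    simp [ellipticProduct, legendreProd, mul_assoc]
  · refine (key (4 * Complex.I ^ 2 / (Real.pi : ℂ) ^ 2) k1 k0).congr hU fun q _ => ?_
    simp [ellipticProduct, legendreProd, mul_assoc]

/-- Analytic continuations of solutions are solutions. -/
theorem IsAppellF2Solution.extend {α β₁ β₂ γ₁ γ₂ : ℂ} {U V : Set (ℂ × ℂ)} {F : ℂ × ℂ → ℂ}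
    (hF : IsAppellF2Solution α β₁ β₂ γ₁ γ₂ U F) (hU : IsOpen U) (hne : U.Nonempty) (hUV : U ⊆ V)
    (hV : IsPreconnected V) (ha : AnalyticOnNhd ℂ F V) :
    IsAppellF2Solution α β₁ β₂ γ₁ γ₂ V F := by
  obtain ⟨z, hz⟩ := hne
  have aX : ∀ q ∈ V, AnalyticAt ℂ (partialX F) q := fun q hq => partialX_analyticAt (ha q hq)
  have aY : ∀ q ∈ V, AnalyticAt ℂ (partialY F) q := fun q hq => partialY_analyticAt (ha q hq)
  have aXX : ∀ q ∈ V, AnalyticAt ℂ (partialX (partialX F)) q := fun q hq =>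
    partialX_analyticAt (aX q hq)
  have aXY : ∀ q ∈ V, AnalyticAt ℂ (partialX (partialY F)) q := fun q hq =>
    partialX_analyticAt (aY q hq)
  have aYY : ∀ q ∈ V, AnalyticAt ℂ (partialY (partialY F)) q := fun q hq =>
    partialY_analyticAt (aY q hq)
  have eX : EqOn (fun q : ℂ × ℂ => q.1 * (1 - q.1) * partialX (partialX F) q
      - q.1 * q.2 * partialX (partialY F) q + (γ₁ - (α + β₁ + 1) * q.1) * partialX F q
      - β₁ * q.2 * partialY F q - α * β₁ * F q) 0 V :=
    AnalyticOnNhd.eqOn_zero_of_preconnected_of_eventuallyEq_zero (𝕜 := ℂ) (fun q hq => by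
        have f1 : AnalyticAt ℂ (fun q : ℂ × ℂ => q.1) q := analyticAt_fst
        have f2 : AnalyticAt ℂ (fun q : ℂ × ℂ => q.2) q := analyticAt_snd
        have h0 := ha q hq
        have h1 := aX q hq
        have h2 := aY q hq
        have h3 := aXX q hq
        have h4 := aXY q hq
        fun_prop) hV (hUV hz)
      ((hU.eventually_mem hz).mono fun q hq => hF.eqX q.1 q.2 hq)
  have eY : EqOn (fun q : ℂ × ℂ => q.2 * (1 - q.2) * partialY (partialY F) q
      - q.1 * q.2 * partialX (partialY F) q + (γ₂ - (α + β₂ + 1) * q.2) * partialY F q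
      - β₂ * q.1 * partialX F q - α * β₂ * F q) 0 V :=
    AnalyticOnNhd.eqOn_zero_of_preconnected_of_eventuallyEq_zero (𝕜 := ℂ) (fun q hq => by
        have f1 : AnalyticAt ℂ (fun q : ℂ × ℂ => q.1) q := analyticAt_fst
        have f2 : AnalyticAt ℂ (fun q : ℂ × ℂ => q.2) q := analyticAt_snd
        have h0 := ha q hq
        have h1 := aX q hq
        have h2 := aY q hq
        have h3 := aYY q hq
        have h4 := aXY q hq
        fun_prop) hV (hUV hz)
      ((hU.eventually_mem hz).mono fun q hq => hF.eqY q.1 q.2 hq)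
  refine ⟨ha, fun x y h => ?_, fun x y h => ?_⟩
  · simpa only [Pi.zero_apply] using eX h
  · simpa only [Pi.zero_apply] using eY h

/-- Continuations of the four products from `U` to `V` form a basis on `V`; the case `V = U` is that
of the products themselves. -/
theorem isSolutionBasis_continuation {U V : Set (ℂ × ℂ)} {lam : ℂ × ℂ → ℂ × ℂ} (hU : IsOpen U)
    (hne : U.Nonempty) (hlam : IsLambdaBranch slitLambdaRange U lam) {P : ℂ × ℂ → Fin 4 → ℂ}
    (hV : IsOpen V) (hVc : IsPreconnected V) (hUV : U ⊆ V)
    (hP : ∀ i, AnalyticOnNhd ℂ (fun q => P q i) V)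
    (hPU : ∀ p ∈ U, P p = ellipticProduct (lam p)) : IsSolutionBasis V P := by
  obtain ⟨z, hz⟩ := hne
  have hr := hlam.mem_range z hz
  have hinv : ∀ᶠ w in 𝓝 z, cdmT (lam w) = w :=
    (hU.eventually_mem hz).mono fun w hw => hlam.inverse w hw
  obtain ⟨⟨n1, n2, n3⟩, _⟩ := lam_partials (hlam.holomorphic z hz).differentiableAt hinv
    (p := (lam z).1) (r := (lam z).2) rfl hr.1.2.2
  obtain ⟨m1, m2⟩ := slitLambdaRange_moduli hr
  have hreg : z ∈ regularLocus := by
    rw [← hlam.inverse z hz]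
    exact cdmT_regular hr.1.2.2 m1 m2 n1 n2 n3
  refine isSolutionBasis_of_independent hV hVc (hUV hz) hreg (fun i => ?_) fun c hc => ?_
  · refine IsAppellF2Solution.extend (U := U) ?_ hU ⟨z, hz⟩ hUV hVc (hP i)
    exact (isAppellF2Solution_ellipticProduct hU hlam i).congr hU fun q hq => by
      simp only [hPU q hq]
  · refine ellipticProduct_independent hr ?_
    rw [← map_nhds_lam (hlam.holomorphic z hz) hinv hr.1.2.2, eventually_map]
    filter_upwards [hU.eventually_mem hz] with q hq
    rw [← hPU q hq]
    exact hc q (hUV hq)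

/-! ### The period over the unit square -/

/-- The arcsine weight `1 / √(t (1 - t))`. -/
noncomputable def arcsineWeight (t : ℝ) : ℝ := (√(t * (1 - t)))⁻¹

theorem arcsineWeight_nonneg (t : ℝ) : 0 ≤ arcsineWeight t := inv_nonneg.2 (Real.sqrt_nonneg _)

theorem integrableOn_arcsineWeight : IntegrableOn arcsineWeight (Icc 0 1) := by
  have h := (Complex.betaIntegral_convergent (u := 1 / 2) (v := 1 / 2) (by norm_num)
    (by norm_num)).norm
  rw [intervalIntegrable_iff_integrableOn_Icc_of_le zero_le_one (by simp)] at h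
  have h' := h.mono_set Ioo_subset_Icc_self
  rw [integrableOn_Icc_iff_integrableOn_Ioo]
  refine h'.congr_fun (fun t ht => ?_) measurableSet_Ioo
  have h0 : 0 ≤ 1 - t := by linarith [ht.2]
  have e : ∀ s : ℝ, 0 ≤ s → ((s : ℂ) ^ ((1 / 2 : ℂ) - 1)) = (((√s)⁻¹ : ℝ) : ℂ) := fun s hs => by
    rw [← invSqrt_ofReal hs, invSqrt]
    norm_num
  simp only
  rw [← Complex.ofReal_one, ← Complex.ofReal_sub, Complex.ofReal_one, e t ht.1.le, e (1 - t) h0,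
    ← Complex.ofReal_mul, Complex.norm_real, Real.norm_of_nonneg (by positivity), arcsineWeight,
    Real.sqrt_mul ht.1.le, mul_inv]

/-- The Banach algebra in which the integrand takes its values as a function of `(x, y)`. -/
abbrev BoundedFun : Type := BoundedContinuousFunction (ℝ × ℝ) ℂ

/-- The coordinate `t₁` on the unit square, extended to the plane by clamping. -/
noncomputable def coordFst : BoundedFun :=
  BoundedContinuousFunction.ofNormedAddCommGroup
    (fun t => ((projIcc (0 : ℝ) 1 zero_le_one t.1 : ℝ) : ℂ))
    (by fun_prop) 1 fun t => by
      have := (projIcc (0 : ℝ) 1 zero_le_one t.1).2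
      rw [Complex.norm_real, Real.norm_of_nonneg this.1]
      exact this.2

/-- The coordinate `t₂` on the unit square, extended to the plane by clamping. -/
noncomputable def coordSnd : BoundedFun :=
  BoundedContinuousFunction.ofNormedAddCommGroup
    (fun t => ((projIcc (0 : ℝ) 1 zero_le_one t.2 : ℝ) : ℂ))
    (by fun_prop) 1 fun t => by
      have := (projIcc (0 : ℝ) 1 zero_le_one t.2).2
      rw [Complex.norm_real, Real.norm_of_nonneg this.1]
      exact this.2

theorem coordFst_apply {t : ℝ × ℝ} (ht : t ∈ unitSquare) : coordFst t = t.1 := by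
  change ((projIcc (0 : ℝ) 1 zero_le_one t.1 : ℝ) : ℂ) = _
  rw [projIcc_of_mem _ ht.1]

theorem coordSnd_apply {t : ℝ × ℝ} (ht : t ∈ unitSquare) : coordSnd t = t.2 := by
  change ((projIcc (0 : ℝ) 1 zero_le_one t.2 : ℝ) : ℂ) = _
  rw [projIcc_of_mem _ ht.2]

theorem norm_coordFst_le : ‖coordFst‖ ≤ 1 :=
  BoundedContinuousFunction.norm_ofNormedAddCommGroup_le _ zero_le_one _

theorem norm_coordSnd_le : ‖coordSnd‖ ≤ 1 :=
  BoundedContinuousFunction.norm_ofNormedAddCommGroup_le _ zero_le_one _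

/-- The domain `‖x‖ + ‖y‖ < 1` on which the binomial series of the integrand converges. -/
def periodDomain : Set (ℂ × ℂ) := {p | ‖p.1‖ + ‖p.2‖ < 1}

theorem isOpen_periodDomain : IsOpen periodDomain := isOpen_lt (by fun_prop) continuous_const

/-- The function `(x, y) ↦ (1 - x t₁ - y t₂)^{-1/2}` with values in a Banach algebra of functions
of `(t₁, t₂)`, defined by the binomial series. -/
noncomputable def integrand (p : ℂ × ℂ) : BoundedFun :=
  (binomialSeries BoundedFun (-(1 / 2) : ℂ)).sum (-(p.1 • coordFst + p.2 • coordSnd))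

theorem one_le_radius_binomialSeries : 1 ≤ (binomialSeries BoundedFun (-(1 / 2) : ℂ)).radius := by
  refine (binomialSeries_radius_ge_one (𝕂 := ℂ) (𝔸 := ℂ) (a := -(1 / 2))).trans
    (FormalMultilinearSeries.radius_le_of_le fun n => ?_)
  simp only [binomialSeries]
  rw [FormalMultilinearSeries.ofScalars_norm, FormalMultilinearSeries.ofScalars_norm]

theorem norm_coords_lt {p : ℂ × ℂ} (hp : p ∈ periodDomain) :
    ‖-(p.1 • coordFst + p.2 • coordSnd)‖ < 1 := by
  rw [norm_neg]
  refine (norm_add_le _ _).trans_lt (lt_of_le_of_lt ?_ hp)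
  rw [norm_smul, norm_smul]
  have h1 := norm_coordFst_le
  have h2 := norm_coordSnd_le
  exact add_le_add (mul_le_of_le_one_right (norm_nonneg _) h1)
    (mul_le_of_le_one_right (norm_nonneg _) h2)

theorem analyticAt_integrand {p : ℂ × ℂ} (hp : p ∈ periodDomain) : AnalyticAt ℂ integrand p := by
  have hS := (binomialSeries BoundedFun (-(1 / 2) : ℂ)).hasFPowerSeriesOnBall
    (zero_lt_one.trans_le one_le_radius_binomialSeries)
  have h1 : AnalyticAt ℂ (binomialSeries BoundedFun (-(1 / 2) : ℂ)).sum
      (-(p.1 • coordFst + p.2 • coordSnd)) := by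
    refine hS.analyticAt_of_mem (Metric.eball_subset_eball one_le_radius_binomialSeries ?_)
    rw [Metric.mem_eball, edist_zero_right, ← ofReal_norm, ENNReal.ofReal_lt_one]
    exact norm_coords_lt hp
  have f1 : AnalyticAt ℂ (fun q : ℂ × ℂ => q.1) p := analyticAt_fst
  have f2 : AnalyticAt ℂ (fun q : ℂ × ℂ => q.2) p := analyticAt_snd
  exact h1.comp_of_eq (((f1.smul analyticAt_const).add (f2.smul analyticAt_const)).neg) rfl

theorem one_sub_mem_slitPlane {p : ℂ × ℂ} (hp : p ∈ periodDomain) (t : ℝ × ℝ) :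
    1 - p.1 * coordFst t - p.2 * coordSnd t ∈ Complex.slitPlane := by
  have h := ((-(p.1 • coordFst + p.2 • coordSnd)).norm_coe_le_norm t).trans_lt (norm_coords_lt hp)
  have := Complex.mem_slitPlane_of_norm_lt_one h
  convert this using 1
  simp
  ring

theorem integrand_apply {p : ℂ × ℂ} (hp : p ∈ periodDomain) (t : ℝ × ℝ) :
    integrand p t = invSqrt (1 - p.1 * coordFst t - p.2 * coordSnd t) := by
  set f : BoundedFun := -(p.1 • coordFst + p.2 • coordSnd) with hf
  have hS := (binomialSeries BoundedFun (-(1 / 2) : ℂ)).hasFPowerSeriesOnBall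
    (zero_lt_one.trans_le one_le_radius_binomialSeries)
  have hfn : ‖f‖ < 1 := norm_coords_lt hp
  have h1 := hS.hasSum (y := f) (Metric.eball_subset_eball one_le_radius_binomialSeries (by
    rw [Metric.mem_eball, edist_zero_right, ← ofReal_norm, ENNReal.ofReal_lt_one]
    exact hfn))
  have h2 := (BoundedContinuousFunction.evalCLM ℂ t).hasSum h1
  have h3 := (Complex.one_add_cpow_hasFPowerSeriesOnBall_zero (a := -(1 / 2))).hasSum
    (y := f t) (by
      rw [Metric.mem_eball, edist_zero_right, ← ofReal_norm, ENNReal.ofReal_lt_one]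
      exact (f.norm_coe_le_norm t).trans_lt hfn)
  have h4 := h2.unique (by
    convert! h3 using 2 with n
    simp only [binomialSeries, FormalMultilinearSeries.ofScalars_apply_eq]
    rfl)
  have e : 1 + (0 + f t) = 1 - p.1 * coordFst t - p.2 * coordSnd t := by
    simp [hf]
    ring
  rw [e] at h4
  rw [invSqrt, ← h4, zero_add]
  rfl

theorem integrable_weights : IntegrableOn
    (fun t : ℝ × ℝ => arcsineWeight t.1 * arcsineWeight t.2) unitSquare := by
  have h : IntegrableOn arcsineWeight (Icc 0 1) := integrableOn_arcsineWeight
  rw [IntegrableOn, unitSquare, Measure.volume_eq_prod, ← Measure.prod_restrict]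
  exact Integrable.mul_prod h h

theorem integrable_weights_mul (f : BoundedFun) : IntegrableOn
    (fun t : ℝ × ℝ => ((arcsineWeight t.1 * arcsineWeight t.2 : ℝ) : ℂ) * f t) unitSquare :=
  Integrable.mul_bdd (c := ‖f‖) integrable_weights.ofReal f.continuous.aestronglyMeasurable
    (ae_of_all _ f.norm_coe_le_norm)

/-- Integration over the unit square against the product of arcsine weights. -/
noncomputable def weightedIntegral : BoundedFun →L[ℂ] ℂ :=
  LinearMap.mkContinuous
    { toFun := fun f =>
        ∫ t in unitSquare, ((arcsineWeight t.1 * arcsineWeight t.2 : ℝ) : ℂ) * f t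
      map_add' := fun f g => by
        rw [← integral_add (integrable_weights_mul f) (integrable_weights_mul g)]
        simp only [BoundedContinuousFunction.coe_add, Pi.add_apply, mul_add]
      map_smul' := fun c f => by
        rw [RingHom.id_apply, smul_eq_mul, ← integral_const_mul]
        simp only [BoundedContinuousFunction.coe_smul, smul_eq_mul, mul_left_comm] }
    (∫ t in unitSquare, arcsineWeight t.1 * arcsineWeight t.2) fun f => by
      rw [← integral_mul_const]
      refine norm_integral_le_of_norm_le (integrable_weights.mul_const _) (ae_of_all _ fun t => ?_)
      rw [norm_mul, Complex.norm_real, Real.norm_of_nonneg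
        (mul_nonneg (arcsineWeight_nonneg _) (arcsineWeight_nonneg _))]
      exact mul_le_mul_of_nonneg_left (f.norm_coe_le_norm t)
        (mul_nonneg (arcsineWeight_nonneg _) (arcsineWeight_nonneg _))

theorem weightedIntegral_apply (f : BoundedFun) : weightedIntegral f =
    ∫ t in unitSquare, ((arcsineWeight t.1 * arcsineWeight t.2 : ℝ) : ℂ) * f t := rfl

theorem measurableSet_unitSquare : MeasurableSet unitSquare :=
  measurableSet_Icc.prod measurableSet_Icc

theorem traintrackForm_eq {p : ℂ × ℂ} (hp : p ∈ periodDomain) {t : ℝ × ℝ} (ht : t ∈ unitSquare) :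
    traintrackForm p.1 (1 - p.2) t =
      ((arcsineWeight t.1 * arcsineWeight t.2 : ℝ) : ℂ) * integrand p t := by
  have hw := Complex.slitPlane_ne_zero (one_sub_mem_slitPlane hp t)
  rw [integrand_apply hp, traintrackForm, one_div_cpow_half]
  have e : (t.1 * t.2 * (1 - t.1) * (1 - t.2) * (1 - p.1 * t.1 - (1 - (1 - p.2)) * t.2) : ℂ) =
      ((t.1 * (1 - t.1) * (t.2 * (1 - t.2)) : ℝ) : ℂ) *
        (1 - p.1 * coordFst t - p.2 * coordSnd t) := by
    rw [coordFst_apply ht, coordSnd_apply ht]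
    push_cast
    ring
  rw [e]
  have h1 : 0 ≤ t.1 * (1 - t.1) := mul_nonneg ht.1.1 (by linarith [ht.1.2])
  have h2 : 0 ≤ t.2 * (1 - t.2) := mul_nonneg ht.2.1 (by linarith [ht.2.2])
  have ew : ((arcsineWeight t.1 * arcsineWeight t.2 : ℝ) : ℂ) =
      invSqrt ((t.1 * (1 - t.1) * (t.2 * (1 - t.2)) : ℝ) : ℂ) := by
    rw [invSqrt_ofReal (mul_nonneg h1 h2), Real.sqrt_mul h1, mul_inv]
    rfl
  rw [ew]
  rcases (mul_nonneg h1 h2).eq_or_lt with h | h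
  · -- on the boundary of the square both sides vanish, `1 / √0` being `0`
    rw [← h]
    simp [invSqrt]
  · exact invSqrt_ofReal_mul h hw

theorem integrableOn_traintrackForm {p : ℂ × ℂ} (hp : p ∈ periodDomain) :
    IntegrableOn (traintrackForm p.1 (1 - p.2)) unitSquare :=
  (integrable_weights_mul (integrand p)).congr_fun (fun _ ht => (traintrackForm_eq hp ht).symm)
    measurableSet_unitSquare

theorem traintrackPeriod_eq {p : ℂ × ℂ} (hp : p ∈ periodDomain) :
    traintrackPeriod p = weightedIntegral (integrand p) :=
  setIntegral_congr_fun measurableSet_unitSquare fun _ ht => traintrackForm_eq hp ht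

/-- Differentiation of the integrand, from its pointwise formula. -/
theorem fderiv_integrand {p : ℂ × ℂ} (hp : p ∈ periodDomain) (v : ℂ × ℂ) :
    fderiv ℂ integrand p v =
      (1 / 2 : ℂ) • ((v.1 • coordFst + v.2 • coordSnd) * integrand p ^ 3) := by
  ext t
  have hd := (analyticAt_integrand hp).differentiableAt.hasFDerivAt
  have h1 : HasFDerivAt (fun q => integrand q t)
      ((BoundedContinuousFunction.evalCLM ℂ t : BoundedFun →L[ℂ] ℂ).comp
        (fderiv ℂ integrand p)) p :=
    ((BoundedContinuousFunction.evalCLM ℂ t : BoundedFun →L[ℂ] ℂ).hasFDerivAt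
      (x := integrand p)).comp p hd
  have hlin : HasFDerivAt (fun q : ℂ × ℂ => 1 - q.1 * coordFst t - q.2 * coordSnd t)
      (-(coordFst t • ContinuousLinearMap.fst ℂ ℂ ℂ) -
        coordSnd t • ContinuousLinearMap.snd ℂ ℂ ℂ) p :=
    ((hasFDerivAt_fst.mul_const (coordFst t)).const_sub 1).sub
      (hasFDerivAt_snd.mul_const (coordSnd t))
  have h2 := ((hasDerivAt_invSqrt (one_sub_mem_slitPlane hp t)).comp_hasFDerivAt p
    hlin).congr_of_eventuallyEq (f₁ := fun q => integrand q t) (by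
      filter_upwards [isOpen_periodDomain.mem_nhds hp] with q hq using integrand_apply hq t)
  have h3 := congrArg (fun φ : ℂ × ℂ →L[ℂ] ℂ => φ v) (h1.unique h2)
  rw [← integrand_apply hp] at h3
  have h4 : (BoundedContinuousFunction.evalCLM ℂ t) (fderiv ℂ integrand p v) =
    fderiv ℂ integrand p v t := rfl
  simp only [ContinuousLinearMap.comp_apply, h4] at h3
  rw [h3]
  simp
  ring

theorem fderiv_weightedIntegral {p : ℂ × ℂ} (hp : p ∈ periodDomain) (c : BoundedFun) (k : ℕ)
    (v : ℂ × ℂ) :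
    fderiv ℂ (fun q => weightedIntegral (c * integrand q ^ k)) p v =
      weightedIntegral ((k / 2 : ℂ) • (c * (v.1 • coordFst + v.2 • coordSnd) *
        integrand p ^ (k + 2))) := by
  have hd := (analyticAt_integrand hp).differentiableAt.hasFDerivAt
  have h1 : HasFDerivAt (fun q => weightedIntegral (c * integrand q ^ k)) _ p :=
    weightedIntegral.hasFDerivAt.comp p ((hd.pow k).const_mul c)
  rw [h1.fderiv]
  simp only [ContinuousLinearMap.comp_apply, smul_apply, fderiv_integrand hp]
  congr 1
  rcases k with _ | k
  · simp
  · ext t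
    simp
    ring

/-- The differential equation in one variable: the weighted integrand is the derivative of
`-√(t (1 - t)) (c - a t)^{-3/2} / 2`, which vanishes at `0` and `1`. -/
theorem integral_arcsineWeight_eq_zero {a c : ℂ}
    (h : ∀ t ∈ Icc (0 : ℝ) 1, c - a * t ∈ Complex.slitPlane) :
    ∫ t in Icc (0 : ℝ) 1, (arcsineWeight t : ℂ) *
      (-(1 / 4) * ((3 * a * t * (1 - t) + (1 - 2 * t) * (c - a * t)) *
        invSqrt (c - a * t) ^ 5)) = 0 := by
  have hlin : ∀ t : ℝ, HasDerivAt (fun t : ℝ => c - a * (t : ℂ)) (-a) t := fun t => by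
    simpa using ((Complex.ofRealCLM.hasDerivAt (x := t)).const_mul a).const_sub c
  have hs : ∀ t ∈ Icc (0 : ℝ) 1, HasDerivAt (fun t : ℝ => invSqrt (c - a * (t : ℂ)))
      (-(1 / 2) * invSqrt (c - a * t) ^ 3 * -a) t := fun t ht =>
    HasDerivAt.comp (h₂ := invSqrt) t (hasDerivAt_invSqrt (h t ht)) (hlin t)
  have hcont : ContinuousOn (fun t : ℝ => invSqrt (c - a * (t : ℂ))) (Icc 0 1) := fun t ht =>
    (hs t ht).continuousAt.continuousWithinAt
  have hsqrt : Continuous fun t : ℝ => ((√(t * (1 - t)) : ℝ) : ℂ) :=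
    Complex.continuous_ofReal.comp (by fun_prop)
  have hint : IntegrableOn (fun t : ℝ => (arcsineWeight t : ℂ) *
      (-(1 / 4) * ((3 * a * t * (1 - t) + (1 - 2 * t) * (c - a * t)) *
        invSqrt (c - a * t) ^ 5))) (Icc 0 1) := by
    have hc : ContinuousOn (fun t : ℝ => -(1 / 4) * ((3 * a * t * (1 - t) +
        (1 - 2 * t) * (c - a * t)) * invSqrt (c - a * t) ^ 5)) (Icc 0 1) :=
      continuousOn_const.mul ((by fun_prop : Continuous fun t : ℝ =>
        3 * a * (t : ℂ) * (1 - t) + (1 - 2 * t) * (c - a * t)).continuousOn.mul (hcont.pow 5))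
    obtain ⟨C, hC⟩ := isCompact_Icc.exists_bound_of_continuousOn hc
    exact Integrable.mul_bdd (c := C) integrableOn_arcsineWeight.ofReal
      (hc.aestronglyMeasurable measurableSet_Icc)
      ((ae_restrict_iff' measurableSet_Icc).2 (ae_of_all _ hC))
  rw [integral_Icc_eq_integral_Ioc, ← intervalIntegral.integral_of_le zero_le_one,
    intervalIntegral.integral_eq_sub_of_hasDerivAt_of_le zero_le_one
      (f := fun t : ℝ => -(1 / 2) * (((√(t * (1 - t)) : ℝ) : ℂ) * invSqrt (c - a * t) ^ 3))
      (continuousOn_const.mul (hsqrt.continuousOn.mul (hcont.pow 3))) (fun t ht => ?_)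
      ((intervalIntegrable_iff_integrableOn_Icc_of_le zero_le_one enorm_ne_top).2 hint)]
  · simp
  · have hpos : 0 < t * (1 - t) := mul_pos ht.1 (by linarith [ht.2])
    have hp : HasDerivAt (fun t : ℝ => t * (1 - t)) (1 * (1 - t) + t * -1) t :=
      (hasDerivAt_id t).mul ((hasDerivAt_id t).const_sub 1)
    have h1 := (hp.sqrt hpos.ne').ofReal_comp
    have h2 := ((hs t (Ioo_subset_Icc_self ht)).pow 3)
    have h3 := (h1.mul h2).const_mul (-(1 / 2) : ℂ)
    have e := invSqrt_sq_mul (Complex.slitPlane_ne_zero (h t (Ioo_subset_Icc_self ht)))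
    have hne : ((√(t * (1 - t)) : ℝ) : ℂ) ≠ 0 := by
      exact_mod_cast (Real.sqrt_pos.2 hpos).ne'
    have hsq : ((√(t * (1 - t)) : ℝ) : ℂ) ^ 2 = t * (1 - t) := by
      exact_mod_cast Real.sq_sqrt hpos.le
    convert! h3 using 1
    simp only [Pi.pow_apply, arcsineWeight]
    push_cast
    generalize invSqrt (c - a * t) = i at *
    generalize ((√(t * (1 - t)) : ℝ) : ℂ) = s at *
    field_simp
    linear_combination -4 * (1 - 2 * (t : ℂ)) * i ^ 3 * e + 12 * a * i ^ 5 * hsq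

/-- Fubini's theorem, with the inner integral over `t₁`. -/
theorem weightedIntegral_eq_zero_fst {f : BoundedFun} (h : ∀ s ∈ Icc (0 : ℝ) 1,
    ∫ t in Icc (0 : ℝ) 1, (arcsineWeight t : ℂ) * f (t, s) = 0) : weightedIntegral f = 0 := by
  have hint := integrable_weights_mul f
  rw [weightedIntegral_apply]
  rw [IntegrableOn, unitSquare, Measure.volume_eq_prod, ← Measure.prod_restrict] at *
  rw [integral_prod_symm _ hint]
  refine setIntegral_eq_zero_of_forall_eq_zero fun s hs => ?_
  calc ∫ t in Icc (0 : ℝ) 1, ((arcsineWeight t * arcsineWeight s : ℝ) : ℂ) * f (t, s)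
      = ∫ t in Icc (0 : ℝ) 1, (arcsineWeight s : ℂ) * ((arcsineWeight t : ℂ) * f (t, s)) := by
        congr 1
        ext t
        push_cast
        ring
    _ = 0 := by rw [integral_const_mul, h s hs, mul_zero]

/-- Fubini's theorem, with the inner integral over `t₂`. -/
theorem weightedIntegral_eq_zero_snd {f : BoundedFun} (h : ∀ s ∈ Icc (0 : ℝ) 1,
    ∫ t in Icc (0 : ℝ) 1, (arcsineWeight t : ℂ) * f (s, t) = 0) : weightedIntegral f = 0 := by
  have hint := integrable_weights_mul f
  rw [weightedIntegral_apply]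
  rw [IntegrableOn, unitSquare, Measure.volume_eq_prod, ← Measure.prod_restrict] at *
  rw [integral_prod _ hint]
  refine setIntegral_eq_zero_of_forall_eq_zero fun s hs => ?_
  calc ∫ t in Icc (0 : ℝ) 1, ((arcsineWeight s * arcsineWeight t : ℝ) : ℂ) * f (s, t)
      = ∫ t in Icc (0 : ℝ) 1, (arcsineWeight s : ℂ) * ((arcsineWeight t : ℂ) * f (s, t)) := by
        congr 1
        ext t
        push_cast
        ring
    _ = 0 := by rw [integral_const_mul, h s hs, mul_zero]

theorem isAppellF2Solution_traintrackPeriod :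
    IsAppellF2Solution (1 / 2) (1 / 2) (1 / 2) 1 1 periodDomain traintrackPeriod := by
  -- the period is `Q 1 1`, and the `Q c k` are closed under differentiation
  set Q : BoundedFun → ℕ → ℂ × ℂ → ℂ := fun c k q => weightedIntegral (c * integrand q ^ k) with hQ
  have dX : ∀ c k, ∀ p ∈ periodDomain, partialX (Q c k) p =
      k / 2 * Q (c * coordFst) (k + 2) p := fun c k p hp => by
    rw [partialX, fderiv_weightedIntegral hp c k, map_smul, smul_eq_mul]
    simp [hQ]
  have dY : ∀ c k, ∀ p ∈ periodDomain, partialY (Q c k) p =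
      k / 2 * Q (c * coordSnd) (k + 2) p := fun c k p hp => by
    rw [partialY, fderiv_weightedIntegral hp c k, map_smul, smul_eq_mul]
    simp [hQ]
  have aQ : ∀ c k, AnalyticOnNhd ℂ (Q c k) periodDomain := fun c k p hp =>
    (weightedIntegral.analyticAt _).comp (analyticAt_const.mul ((analyticAt_integrand hp).pow k))
  have hsol : IsAppellF2Solution (1 / 2) (1 / 2) (1 / 2) 1 1 periodDomain (Q 1 1) := by
    have eX : ∀ p ∈ periodDomain, partialX (Q 1 1) =ᶠ[𝓝 p]
        fun q => 1 / 2 * Q (1 * coordFst) 3 q + (fun _ => 0) q := fun p hp => by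
      filter_upwards [isOpen_periodDomain.mem_nhds hp] with q hq
      simpa using dX 1 1 q hq
    have eY : ∀ p ∈ periodDomain, partialY (Q 1 1) =ᶠ[𝓝 p]
        fun q => 1 / 2 * Q (1 * coordSnd) 3 q + (fun _ => 0) q := fun p hp => by
      filter_upwards [isOpen_periodDomain.mem_nhds hp] with q hq
      simpa using dY 1 1 q hq
    have h0 : ∀ p, partialX (fun _ => (0 : ℂ)) p = 0 ∧ partialY (fun _ => (0 : ℂ)) p = 0 :=
      fun p => by simp [partialX, partialY]
    have eXX : ∀ p ∈ periodDomain, partialX (partialX (Q 1 1)) p =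
        3 / 4 * Q (1 * coordFst * coordFst) 5 p := fun p hp => by
      rw [(partial_congr (eX p hp)).1, (partial_smul_add _ (aQ _ _ p hp) analyticAt_const).1,
        dX _ _ p hp, (h0 p).1]
      push_cast
      ring
    have eXY : ∀ p ∈ periodDomain, partialX (partialY (Q 1 1)) p =
        3 / 4 * Q (1 * coordSnd * coordFst) 5 p := fun p hp => by
      rw [(partial_congr (eY p hp)).1, (partial_smul_add _ (aQ _ _ p hp) analyticAt_const).1,
        dX _ _ p hp, (h0 p).1]
      push_cast
      ring
    have eYY : ∀ p ∈ periodDomain, partialY (partialY (Q 1 1)) p =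
        3 / 4 * Q (1 * coordSnd * coordSnd) 5 p := fun p hp => by
      rw [(partial_congr (eY p hp)).2, (partial_smul_add _ (aQ _ _ p hp) analyticAt_const).2,
        dY _ _ p hp, (h0 p).2]
      push_cast
      ring
    refine ⟨aQ 1 1, fun x y hp => ?_, fun x y hp => ?_⟩
    · rw [eXX _ hp, eXY _ hp, (eX _ hp).self_of_nhds, (eY _ hp).self_of_nhds]
      set G := integrand (x, y) with hG
      have hz := weightedIntegral_eq_zero_fst (f := (x * (1 - x) * (3 / 4)) •
        (1 * coordFst * coordFst * G ^ 5) - (x * y * (3 / 4)) • (1 * coordSnd * coordFst * G ^ 5) +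
        ((1 - 2 * x) * (1 / 2)) • (1 * coordFst * G ^ 3) -
        (1 / 2 * y * (1 / 2)) • (1 * coordSnd * G ^ 3) - (1 / 4 : ℂ) • (1 * G ^ 1)) fun s hs => by
        have hsl : ∀ t ∈ Icc (0 : ℝ) 1, (1 - y * s) - x * t ∈ Complex.slitPlane := fun t ht => by
          have := one_sub_mem_slitPlane hp (t, s)
          rw [coordFst_apply ⟨ht, hs⟩, coordSnd_apply ⟨ht, hs⟩] at this
          convert this using 1
          ring
        rw [← integral_arcsineWeight_eq_zero hsl]
        refine setIntegral_congr_fun measurableSet_Icc fun t ht => ?_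
        have e1 : G (t, s) = invSqrt ((1 - y * s) - x * t) := by
          rw [hG, integrand_apply hp, coordFst_apply ⟨ht, hs⟩, coordSnd_apply ⟨ht, hs⟩]
          congr 1
          ring
        have e := invSqrt_sq_mul (Complex.slitPlane_ne_zero (hsl t ht))
        simp only [BoundedContinuousFunction.coe_sub, BoundedContinuousFunction.coe_add,
          BoundedContinuousFunction.coe_smul, BoundedContinuousFunction.coe_mul,
          BoundedContinuousFunction.coe_pow, BoundedContinuousFunction.coe_one, Pi.sub_apply,
          Pi.add_apply, Pi.mul_apply, Pi.pow_apply, Pi.one_apply, smul_eq_mul, e1,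
          coordFst_apply (t := (t, s)) ⟨ht, hs⟩, coordSnd_apply (t := (t, s)) ⟨ht, hs⟩]
        generalize invSqrt (1 - y * s - x * t) = i at *
        linear_combination (arcsineWeight t : ℂ) * (-((1 - 2 * x) / 2 * t - y * s / 4) * i ^ 3
          + i / 4 * (i ^ 2 * (1 - y * s - x * t) + 1)) * e
      simp only [map_sub, map_add, map_smul, smul_eq_mul] at hz
      linear_combination hz
    · rw [eYY _ hp, eXY _ hp, (eX _ hp).self_of_nhds, (eY _ hp).self_of_nhds]
      set G := integrand (x, y) with hG
      have hz := weightedIntegral_eq_zero_snd (f := (y * (1 - y) * (3 / 4)) •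
        (1 * coordSnd * coordSnd * G ^ 5) - (x * y * (3 / 4)) • (1 * coordSnd * coordFst * G ^ 5) +
        ((1 - 2 * y) * (1 / 2)) • (1 * coordSnd * G ^ 3) -
        (1 / 2 * x * (1 / 2)) • (1 * coordFst * G ^ 3) - (1 / 4 : ℂ) • (1 * G ^ 1)) fun s hs => by
        have hsl : ∀ t ∈ Icc (0 : ℝ) 1, (1 - x * s) - y * t ∈ Complex.slitPlane := fun t ht => by
          have := one_sub_mem_slitPlane hp (s, t)
          rwa [coordFst_apply ⟨hs, ht⟩, coordSnd_apply ⟨hs, ht⟩] at this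
        rw [← integral_arcsineWeight_eq_zero hsl]
        refine setIntegral_congr_fun measurableSet_Icc fun t ht => ?_
        have e1 : G (s, t) = invSqrt ((1 - x * s) - y * t) := by
          rw [hG, integrand_apply hp, coordFst_apply ⟨hs, ht⟩, coordSnd_apply ⟨hs, ht⟩]
        have e := invSqrt_sq_mul (Complex.slitPlane_ne_zero (hsl t ht))
        simp only [BoundedContinuousFunction.coe_sub, BoundedContinuousFunction.coe_add,
          BoundedContinuousFunction.coe_smul, BoundedContinuousFunction.coe_mul,
          BoundedContinuousFunction.coe_pow, BoundedContinuousFunction.coe_one, Pi.sub_apply,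
          Pi.add_apply, Pi.mul_apply, Pi.pow_apply, Pi.one_apply, smul_eq_mul, e1,
          coordFst_apply (t := (s, t)) ⟨hs, ht⟩, coordSnd_apply (t := (s, t)) ⟨hs, ht⟩]
        generalize invSqrt (1 - x * s - y * t) = i at *
        linear_combination (arcsineWeight t : ℂ) * (-((1 - 2 * y) / 2 * t - x * s / 4) * i ^ 3
          + i / 4 * (i ^ 2 * (1 - x * s - y * t) + 1)) * e
      simp only [map_sub, map_add, map_smul, smul_eq_mul] at hz
      linear_combination hz
  exact hsol.congr isOpen_periodDomain fun p hp => by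
    rw [traintrackPeriod_eq hp]
    simp [hQ]

/-! ### The inverse of the change of variables at the origin -/

/-- The principal square root. -/
noncomputable def csqrt (w : ℂ) : ℂ := w ^ ((2 : ℕ) : ℂ)⁻¹

theorem csqrt_sq (w : ℂ) : csqrt w ^ 2 = w := Complex.cpow_nat_inv_pow w two_ne_zero

theorem csqrt_eq {v w : ℂ} (h : v = w ^ 2) (hw : 0 < w.re) : csqrt v = w := by
  rw [h]
  exact_mod_cast Complex.sq_cpow_two_inv hw

theorem csqrt_one : csqrt 1 = 1 := csqrt_eq (by norm_num) (by norm_num)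

theorem analyticAt_csqrt {w : ℂ} (hw : w ∈ Complex.slitPlane) : AnalyticAt ℂ csqrt w :=
  analyticAt_id.cpow analyticAt_const hw

/-- The inverse of `T` with value `(0, 1)` at the origin, in closed form: with `a = √(1 - x)`,
`b = √(1 - y)` and `c = √(1 - x - y)`, it is `((1 - a) / (b + c), (1 + a) / (b + c))`. -/
noncomputable def originBranch (p : ℂ × ℂ) : ℂ × ℂ :=
  ((1 - csqrt (1 - p.1)) / (csqrt (1 - p.2) + csqrt (1 - p.1 - p.2)),
    (1 + csqrt (1 - p.1)) / (csqrt (1 - p.2) + csqrt (1 - p.1 - p.2)))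

theorem originBranch_zero : originBranch (0, 0) = (0, 1) := by
  simp [originBranch, csqrt_one]

theorem cdmT_originBranch {p : ℂ × ℂ} (h : csqrt (1 - p.2) + csqrt (1 - p.1 - p.2) ≠ 0) :
    cdmT (originBranch p) = p := by
  have ha := csqrt_sq (1 - p.1)
  have hb := csqrt_sq (1 - p.2)
  have hc := csqrt_sq (1 - p.1 - p.2)
  have hs : (originBranch p).1 + (originBranch p).2 ≠ 0 := by
    simp only [originBranch]
    rw [← add_div]
    exact div_ne_zero (by ring_nf; norm_num) h
  simp only [originBranch] at hs
  obtain ⟨x, y⟩ := p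
  simp only [cdmT, originBranch] at *
  generalize csqrt (1 - x) = a at *
  generalize csqrt (1 - y) = b at *
  generalize csqrt (1 - x - y) = c at *
  have hs2 := pow_ne_zero 2 hs
  refine Prod.ext ?_ ?_
  · simp only
    rw [div_eq_iff hs2]
    field_simp
    linear_combination -4 * ha
  · simp only
    rw [div_eq_iff hs2]
    field_simp
    linear_combination (2 * (b + c) ^ 2 + 2 * x - (a ^ 2 - (1 - x))) * ha
      + (-2 * (b + c) ^ 2 + 2 * x + (b ^ 2 - (1 - y)) - (c ^ 2 - (1 - x - y))) * hb
      + (-2 * (b + c) ^ 2 - 2 * x - (b ^ 2 - (1 - y)) + (c ^ 2 - (1 - x - y))) * hc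

theorem originBranch_cdmT {l : ℂ × ℂ} (hs : l.1 + l.2 ≠ 0)
    (h1 : 0 < ((l.2 - l.1) / (l.1 + l.2)).re) (h2 : 0 < ((1 + l.1 * l.2) / (l.1 + l.2)).re)
    (h3 : 0 < ((1 - l.1 * l.2) / (l.1 + l.2)).re) : originBranch (cdmT l) = l := by
  have ea : csqrt (1 - (cdmT l).1) = (l.2 - l.1) / (l.1 + l.2) :=
    csqrt_eq (by simp only [cdmT]; field_simp; ring) h1
  have eb : csqrt (1 - (cdmT l).2) = (1 + l.1 * l.2) / (l.1 + l.2) :=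
    csqrt_eq (by simp only [cdmT]; field_simp; ring) h2
  have ec : csqrt (1 - (cdmT l).1 - (cdmT l).2) = (1 - l.1 * l.2) / (l.1 + l.2) :=
    csqrt_eq (by simp only [cdmT]; field_simp; ring) h3
  have e : (1 + l.1 * l.2) / (l.1 + l.2) + (1 - l.1 * l.2) / (l.1 + l.2) = 2 / (l.1 + l.2) := by
    rw [← add_div]; ring
  rw [originBranch, ea, eb, ec, e]
  refine Prod.ext ?_ ?_
  · simp only
    field_simp
    ring
  · simp only
    field_simp
    ring

theorem sq_mem_slitPlane {w : ℂ} (hw : w.re ≠ 0) : w ^ 2 ∈ Complex.slitPlane := by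
  rw [Complex.mem_slitPlane_iff, sq, Complex.mul_re, Complex.mul_im]
  by_cases h : w.im = 0
  · left
    rw [h]
    simpa using mul_self_pos.2 hw
  · right
    rw [mul_comm w.im, ← two_mul]
    simp [hw, h]

theorem one_sub_sq_mem_slitPlane {w : ℂ} (hw : w.im ≠ 0) : 1 - w ^ 2 ∈ Complex.slitPlane := by
  rw [Complex.mem_slitPlane_iff, sq, Complex.sub_re, Complex.sub_im, Complex.mul_re,
    Complex.mul_im, Complex.one_re, Complex.one_im]
  by_cases h : w.re = 0
  · left
    rw [h]
    nlinarith [mul_self_nonneg w.im]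
  · right
    rw [mul_comm w.im, ← two_mul]
    simp [hw, h]

/-- The points at which the principal branches of the elliptic integrals are holomorphic are
dense. -/
theorem frequently_slit (l : ℂ × ℂ) : ∃ᶠ w : ℂ × ℂ in 𝓝 l,
    w.1 ^ 2 ∈ Complex.slitPlane ∧ 1 - w.2 ^ 2 ∈ Complex.slitPlane := by
  have hne : ∀ r : ℝ, ∀ᶠ ε in 𝓝[≠] (0 : ℝ), r + ε ≠ 0 := by
    intro r
    rcases eq_or_ne r 0 with rfl | hr
    · filter_upwards [self_mem_nhdsWithin] with ε hε
      simpa using hε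
    · have hc : ContinuousAt (fun ε : ℝ => r + ε) 0 := by fun_prop
      exact (hc.eventually_ne (by simpa using hr)).filter_mono nhdsWithin_le_nhds
  have ht : Tendsto (fun ε : ℝ => ((l.1 + ε, l.2 + ε * Complex.I) : ℂ × ℂ)) (𝓝[≠] 0) (𝓝 l) := by
    have hc : Continuous fun ε : ℝ => ((l.1 + ε, l.2 + ε * Complex.I) : ℂ × ℂ) := by fun_prop
    refine Tendsto.mono_left ?_ nhdsWithin_le_nhds
    simpa using hc.tendsto 0
  refine ht.frequently (Eventually.frequently ?_)
  filter_upwards [hne l.1.re, hne l.2.im] with ε h1 h2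
  exact ⟨sq_mem_slitPlane (by simpa using h1), one_sub_sq_mem_slitPlane (by simpa using h2)⟩

theorem exists_lambdaBranch_origin : ∃ (N : Set (ℂ × ℂ)) (lam : ℂ × ℂ → ℂ × ℂ),
    IsOpen N ∧ IsConnected N ∧ (0, 0) ∈ N ∧ IsLambdaBranch lambdaRange N lam ∧
    lam (0, 0) = (0, 1) ∧ N ⊆ closure {p ∈ N | lam p ∈ slitLambdaRange} ∧ N ⊆ periodDomain := by
  have cne : ContinuousAt (fun p : ℂ × ℂ => p.1 + p.2) (0, 1) := by fun_prop
  -- conditions on `lam` that hold near `(0, 1)`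
  have hgood : ∀ᶠ l : ℂ × ℂ in 𝓝 (0, 1), l ∈ lambdaRange ∧ originBranch (cdmT l) = l := by
    have c1 : ContinuousAt (fun l : ℂ × ℂ => ‖l.1 ^ 2‖) (0, 1) := by fun_prop
    have c2 : ContinuousAt (fun l : ℂ × ℂ => ‖1 - l.2 ^ 2‖) (0, 1) := by fun_prop
    have hs0 : ((0, 1) : ℂ × ℂ).1 + ((0, 1) : ℂ × ℂ).2 ≠ 0 := by simp
    have c3 : ContinuousAt (fun l : ℂ × ℂ => ((l.2 - l.1) / (l.1 + l.2)).re) (0, 1) :=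
      Complex.continuous_re.continuousAt.comp (ContinuousAt.div (by fun_prop) cne hs0)
    have c4 : ContinuousAt (fun l : ℂ × ℂ => ((1 + l.1 * l.2) / (l.1 + l.2)).re) (0, 1) :=
      Complex.continuous_re.continuousAt.comp (ContinuousAt.div (by fun_prop) cne hs0)
    have c5 : ContinuousAt (fun l : ℂ × ℂ => ((1 - l.1 * l.2) / (l.1 + l.2)).re) (0, 1) :=
      Complex.continuous_re.continuousAt.comp (ContinuousAt.div (by fun_prop) cne hs0)
    filter_upwards [cne.eventually_ne hs0, c1.eventually_lt_const (u := 1) (by simp),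
      c2.eventually_lt_const (u := 1) (by simp), c3.eventually_const_lt (u := 0) (by simp),
      c4.eventually_const_lt (u := 0) (by simp), c5.eventually_const_lt (u := 0) (by simp)]
      with l hs h1 h2 h3 h4 h5
    exact ⟨⟨h1, h2, hs⟩, originBranch_cdmT hs h3 h4 h5⟩
  have han : ∀ᶠ p : ℂ × ℂ in 𝓝 (0, 0), AnalyticAt ℂ originBranch p ∧
      csqrt (1 - p.2) + csqrt (1 - p.1 - p.2) ≠ 0 ∧ p ∈ periodDomain := by
    have f1 : AnalyticAt ℂ (fun p : ℂ × ℂ => p.1) (0, 0) := analyticAt_fst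
    have f2 : AnalyticAt ℂ (fun p : ℂ × ℂ => p.2) (0, 0) := analyticAt_snd
    have g1 : AnalyticAt ℂ (fun p : ℂ × ℂ => csqrt (1 - p.1)) (0, 0) :=
      (analyticAt_csqrt (w := 1) (by simp)).comp_of_eq (analyticAt_const.sub f1) (by simp)
    have g2 : AnalyticAt ℂ (fun p : ℂ × ℂ => csqrt (1 - p.2)) (0, 0) :=
      (analyticAt_csqrt (w := 1) (by simp)).comp_of_eq (analyticAt_const.sub f2) (by simp)
    have g3 : AnalyticAt ℂ (fun p : ℂ × ℂ => csqrt (1 - p.1 - p.2)) (0, 0) :=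
      (analyticAt_csqrt (w := 1) (by simp)).comp_of_eq ((analyticAt_const.sub f1).sub f2) (by simp)
    have h0 : csqrt (1 - ((0, 0) : ℂ × ℂ).2) +
        csqrt (1 - ((0, 0) : ℂ × ℂ).1 - ((0, 0) : ℂ × ℂ).2) ≠ 0 := by
      simp [csqrt_one]
    have ha : AnalyticAt ℂ originBranch (0, 0) :=
      ((analyticAt_const.sub g1).div (g2.add g3) h0).prod
        ((analyticAt_const.add g1).div (g2.add g3) h0)
    refine ha.eventually_analyticAt.and (((g2.add g3).continuousAt.eventually_ne h0).and ?_)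
    exact isOpen_periodDomain.mem_nhds (by simp [periodDomain])
  have hcont : Tendsto originBranch (𝓝 (0, 0)) (𝓝 (0, 1)) := by
    have := han.self_of_nhds.1.continuousAt.tendsto
    rwa [originBranch_zero] at this
  obtain ⟨ε, hε, hball⟩ := Metric.eventually_nhds_iff_ball.1
    (han.and (hcont.eventually hgood.eventually_nhds))
  refine ⟨Metric.ball (0, 0) ε, originBranch, Metric.isOpen_ball,
    ((convex_ball _ _).isPathConnected ⟨_, Metric.mem_ball_self hε⟩).isConnected,
    Metric.mem_ball_self hε, ⟨fun p hp => (hball p hp).1.1,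
      fun p hp => (hball p hp).2.self_of_nhds.1, fun p hp => cdmT_originBranch (hball p hp).1.2.1⟩,
    originBranch_zero, fun p hp => ?_, fun p hp => (hball p hp).1.2.2⟩
  have hT : cdmT (originBranch p) = p := cdmT_originBranch (hball p hp).1.2.1
  have hs := (hball p hp).2.self_of_nhds.1.2.2
  have cT : ContinuousAt cdmT (originBranch p) :=
    ContinuousAt.prodMk (ContinuousAt.div (by fun_prop) (by fun_prop) (pow_ne_zero 2 hs))
      (ContinuousAt.div (by fun_prop) (by fun_prop) (pow_ne_zero 2 hs))
  have tT : Tendsto cdmT (𝓝 (originBranch p)) (𝓝 p) := by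
    simpa only [ContinuousAt, hT] using cT
  rw [mem_closure_iff_frequently]
  refine tT.frequently ?_
  have hev := (hball p hp).2.and (tT.eventually (Metric.isOpen_ball.mem_nhds hp))
  refine ((frequently_slit (originBranch p)).and_eventually hev).mono fun l hl => ?_
  obtain ⟨⟨h1, h2⟩, ⟨h3, h4⟩, h5⟩ := hl
  refine ⟨h5, ?_⟩
  rw [h4]
  exact ⟨h3, h1, h2⟩

theorem mainTheorem1 :
    -- Near the origin the change of variables is invertible, and the integral of the two-form
    -- over the unit square solves the system.
    (∃ (N : Set (ℂ × ℂ)) (lam : ℂ × ℂ → ℂ × ℂ),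
      IsOpen N ∧ IsConnected N ∧ (0, 0) ∈ N ∧
      IsLambdaBranch lambdaRange N lam ∧ lam (0, 0) = (0, 1) ∧
      N ⊆ closure {p ∈ N | lam p ∈ slitLambdaRange} ∧
      (∀ p ∈ N, IntegrableOn (traintrackForm p.1 (1 - p.2)) unitSquare) ∧
      (fun p : N => traintrackPeriod p) ∈ traintrackSolutions N) ∧
    -- The four products form a basis of solutions, and so do their analytic continuations.
    (∀ (U : Set (ℂ × ℂ)) (lam : ℂ × ℂ → ℂ × ℂ),
      IsOpen U → IsConnected U → IsLambdaBranch slitLambdaRange U lam →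
      IsSolutionBasis U (fun p => ellipticProduct (lam p)) ∧
      ∀ (V : Set (ℂ × ℂ)) (P : ℂ × ℂ → Fin 4 → ℂ),
        IsOpen V → IsConnected V → U ⊆ V → AnalyticOnNhd ℂ P V →
        (∀ p ∈ U, P p = ellipticProduct (lam p)) →
        IsSolutionBasis V P) := by
  refine ⟨?_, fun U lam hU hUc hlam => ⟨?_, fun V P hV hVc hUV hP hPU => ?_⟩⟩
  · obtain ⟨N, lam, hN, hc, h0, hb, hl, hd, hsub⟩ := exists_lambdaBranch_origin
    refine ⟨N, lam, hN, hc, h0, hb, hl, hd, fun p hp => integrableOn_traintrackForm (hsub hp),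
      traintrackPeriod, ⟨?_, ?_, ?_⟩, fun _ => rfl⟩
    · exact fun p hp => isAppellF2Solution_traintrackPeriod.holomorphic p (hsub hp)
    · exact fun x y hp => isAppellF2Solution_traintrackPeriod.eqX x y (hsub hp)
    · exact fun x y hp => isAppellF2Solution_traintrackPeriod.eqY x y (hsub hp)
  · exact isSolutionBasis_continuation hU hUc.nonempty hlam hU hUc.isPreconnected subset_rfl
      (fun i => (isAppellF2Solution_ellipticProduct hU hlam i).holomorphic) fun _ _ => rfl
  · exact isSolutionBasis_continuation hU hUc.nonempty hlam hV hVc.isPreconnected hUV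
      (fun i p hp => (ContinuousLinearMap.proj (R := ℂ) (φ := fun _ : Fin 4 => ℂ) i).analyticAt _
        |>.comp (hP p hp)) hPU
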